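/- Let $\mathbb K$ be a field of characteristic zero and $\mathcal D$ a nonempty set. Let $\mathbf H_{CK}^{\mathcal D}$ be the Connes–Kreimer Hopf algebra: the vector space with basis the isomorphism classes of finite rooted forests with vertices decorated by $\mathcal D$ (including the empty forest $1$), with product the disjoint union, and coproduct $\Delta(F)=\sum_{\boldsymbol v} Lea_{\boldsymbol v}(F)\otimes Roo_{\boldsymbol v}(F)$. Edges are oriented towards the roots, $v\twoheadrightarrow w$ means that there is an oriented path (possibly of length $0$) from $v$ to $w$, the sum is over all admissible cuts, that is, sets $\boldsymbol v$ of vertices such that $v\twoheadrightarrow w$ for no two different $v,w\in\boldsymbol v$; $Lea_{\boldsymbol v}(F)$ is the forest on the vertices $w$ with $w\twoheadrightarrow v$ for some $v\in\boldsymbol v$, and $Roo_{\boldsymbol v}(F)$ the forest on the other vertices. Let $\mathbf{Sh}^{\mathcal D}$ be the shuffle Hopf algebra: the vector space with basis the words in $\mathcal D$, with the shuffle product and the deconcatenation coproduct. Let $\mathbb T^{\mathcal D}$ be the set of isomorphism classes of nonempty $\mathcal D$-decorated rooted trees, $\mathbb K(X)$ the vector space with basis $X$, $i:\mathbb K(\mathbb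 T^{\mathcal D})\hookrightarrow \mathbf H_{CK}^{\mathcal D}$ the inclusion and $\pi:\mathbf{Sh}^{\mathcal D}\to\mathbb K(\mathcal D)$ the projection onto words of length one (killing all other words). Let $\varphi:\mathbb K(\mathbb T^{\mathcal D})\to\mathbb K(\mathcal D)$ be a linear map. There is a unique Hopf algebra morphism $\Phi:\mathbf H_{CK}^{\mathcal D}\to\mathbf{Sh}^{\mathcal D}$ with $\pi\circ\Phi\circ i=\varphi$, and for every nonempty $\mathcal D$-decorated rooted tree $T$ $$\Phi(T)=\sum_{\boldsymbol e\subseteq E(T)}\ \sum_{\sigma\in\mathcal O(Cont_{\boldsymbol e}(T))}\varphi(\sigma^{-1}(k))\cdots\varphi(\sigma^{-1}(1)),\qquad k=|V(Cont_{\boldsymbol e}(T))| .$$ Here $\boldsymbol e$ runs over all subsets of the set $E(T)$ of edges, $Part_{\boldsymbol e}(T)$ is the decorated forest with all the vertices of $T$ and the edges in $\boldsymbol e$, $Cont_{\boldsymbol e}(T)$ is the rooted tree obtained from $T$ by contracting the edges in $\boldsymbol e$, whose vertices are the connected components of $Part_{\boldsymbol e}(T)$; $\mathcal O(Cont_{\boldsymbol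 e}(T))$ is the set of bijections $\sigma:V(Cont_{\boldsymbol e}(T))\to\{1,\dots,k\}$ such that $a\twoheadrightarrow b$ implies $\sigma(a)\ge\sigma(b)$; $\sigma^{-1}(j)$ is regarded as a decorated tree, a connected component of $Part_{\boldsymbol e}(T)$; and the product $x_1\cdots x_k$ of elements of $\mathbb K(\mathcal D)$ is the multilinear extension of $(d_1,\dots,d_k)\mapsto$ the word $d_1\dots d_k$ (concatenation, not shuffle). -/

import Mathlib

open scoped TensorProduct

noncomputable section

namespace CKShuffle

/-! ## Rooted forests -/

/-- A rooted forest with vertex set `V` (finite in all uses), given by its edges oriented downwards,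
from the leaves to the roots: `edge v w` means `v → w`. A finite directed graph is such an oriented
forest of rooted trees iff every vertex has at most one outgoing edge and there is no oriented
cycle; the roots are the vertices without outgoing edge. -/
structure RootedForest (V : Type*) where
  edge : V → V → Prop
  edge_unique : ∀ {u v w : V}, edge u v → edge u w → v = w
  acyclic : ∀ v : V, ¬ Relation.TransGen edge v v

namespace RootedForest

variable {V W : Type*}

/-- `F.Above v w` is `v ↠ w`: there is an oriented path (possibly of length `0`) from `v` to `w`. -/
def Above (F : RootedForest V) : V → V → Prop := Relation.ReflTransGen F.edge

/-- The set of edges. -/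
def edgeSet (F : RootedForest V) : Set (V × V) := {p | F.edge p.1 p.2}

/-- The underlying unoriented graph. -/
def graph (F : RootedForest V) : SimpleGraph V := SimpleGraph.fromRel F.edge

/-- A nonempty rooted tree: the underlying graph is connected (in particular nonempty). -/
def IsTree (F : RootedForest V) : Prop := F.graph.Connected

/-- Pull a forest back along an injective map. For the inclusion of a subset it is the forest on
this subset with all the edges between its vertices; for a bijection it is relabelling. -/
def comap (F : RootedForest V) (f : W ↪ V) : RootedForest W where
  edge u w := F.edge (f u) (f w)
  edge_unique h h' := f.injective (F.edge_unique h h')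
  acyclic v h := F.acyclic (f v) (Relation.TransGen.lift f (fun _ _ h => h) _ _ h)

/-- Keep only the vertices of `S` and the edges between them. -/
def induce (F : RootedForest V) (S : Set V) : RootedForest S :=
  F.comap (Function.Embedding.subtype (· ∈ S))

/-- Disjoint union of rooted forests. -/
def sum (F : RootedForest V) (G : RootedForest W) : RootedForest (V ⊕ W) where
  edge := Sum.LiftRel F.edge G.edge
  edge_unique := by
    rintro _ _ _ (h | h) (h' | h')
    · rw [F.edge_unique h h']
    · rw [G.edge_unique h h']
  acyclic := by
    have key : ∀ x y, Relation.TransGen (Sum.LiftRel F.edge G.edge) x y →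
        Sum.LiftRel (Relation.TransGen F.edge) (Relation.TransGen G.edge) x y := by
      intro x y h
      induction h with
      | single h =>
        cases h with
        | inl h => exact .inl (.single h)
        | inr h => exact .inr (.single h)
      | tail _ h ih =>
        cases ih with
        | inl i => cases h with | inl h => exact .inl (i.tail h)
        | inr i => cases h with | inr h => exact .inr (i.tail h)
    intro x h
    cases key x x h with
    | inl h => exact F.acyclic _ h
    | inr h => exact G.acyclic _ h

/-! ### Admissible cuts -/

/-- Admissible cuts: sets of vertices, no two different elements of which are joined by an
oriented path. -/
def AdmissibleCut (F : RootedForest V) : Type _ :=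
  {v : Set V // ∀ a ∈ v, ∀ b ∈ v, a ≠ b → ¬ F.Above a b}

instance (F : RootedForest V) [Finite V] : Fintype F.AdmissibleCut :=
  @Fintype.ofFinite _ (inferInstanceAs (Finite {_v : Set V // _}))

/-- The vertices above the cut (those of `Lea`). -/
def AdmissibleCut.lea {F : RootedForest V} (v : F.AdmissibleCut) : Set V :=
  {w | ∃ a ∈ v.1, F.Above w a}

/-- The other vertices (those of `Roo`). -/
def AdmissibleCut.roo {F : RootedForest V} (v : F.AdmissibleCut) : Set V := v.leaᶜ

/-! ### Contractions -/

/-- Contractions: arbitrary subsets of the set of edges. -/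
def Contraction (F : RootedForest V) : Type _ := {e : Set (V × V) // e ⊆ F.edgeSet}

instance (F : RootedForest V) [Finite V] : Fintype F.Contraction :=
  @Fintype.ofFinite _ (inferInstanceAs (Finite {_e : Set (V × V) // _}))

/-- `Part_e(F)`: keep all the vertices, and only the edges in `e`. -/
def part (F : RootedForest V) (e : Set (V × V)) : RootedForest V where
  edge u w := F.edge u w ∧ (u, w) ∈ e
  edge_unique h h' := F.edge_unique h.1 h'.1
  acyclic v h := F.acyclic v (Relation.TransGen.mono (fun _ _ h => h.1) _ _ h)

/-- The connected components of `Part_e(F)`, which are the vertices of `Cont_e(F)`. -/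
abbrev Block (F : RootedForest V) (e : Set (V × V)) : Type _ :=
  (F.part e).graph.ConnectedComponent

/-- The connected component of `Part_e(F)` containing `v`. -/
abbrev blockMk (F : RootedForest V) (e : Set (V × V)) (v : V) : F.Block e :=
  (F.part e).graph.connectedComponentMk v

/-- Two vertices of one connected component have a common vertex below them. -/
theorem exists_above_above_of_reachable (F : RootedForest V) {u w : V}
    (h : F.graph.Reachable u w) : ∃ x, F.Above u x ∧ F.Above w x := by
  have eqv : Equivalence (Relation.Join (Relation.ReflTransGen F.edge)) :=
    Relation.equivalence_join_reflTransGen fun a b c hb hc =>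
      ⟨c, by rw [F.edge_unique hb hc], .refl⟩
  rw [SimpleGraph.reachable_iff_reflTransGen] at h
  change Relation.Join (Relation.ReflTransGen F.edge) u w
  induction h with
  | refl => exact eqv.refl _
  | tail _ hab ih =>
    refine eqv.trans ih ?_
    rcases hab.2 with h | h
    · exact ⟨_, .single h, .refl⟩
    · exact ⟨_, .refl, .single h⟩

/-- A vertex whose outgoing edge is not in `e` is below its whole component of `Part_e(F)`. -/
theorem part_above_of_exit (F : RootedForest V) {e : Set (V × V)} {u w x : V}
    (hu : F.edge u w) (he : (u, w) ∉ e) (hx : F.blockMk e x = F.blockMk e u) :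
    (F.part e).Above x u := by
  obtain ⟨y, hxy, huy⟩ :=
    (F.part e).exists_above_above_of_reachable (SimpleGraph.ConnectedComponent.exact hx)
  rcases Relation.ReflTransGen.cases_head huy with rfl | ⟨z, hz, _⟩
  · exact hxy
  · exact absurd (F.edge_unique hu hz.1 ▸ hz.2) he

/-- `Cont_e(F)`: contract each edge in `e`. The vertices are the connected components of
`Part_e(F)` and the edges come from the edges of `F` that are not in `e`. -/
def cont (F : RootedForest V) (e : Set (V × V)) : RootedForest (F.Block e) where
  edge C C' := ∃ u w, F.blockMk e u = C ∧ F.blockMk e w = C' ∧ F.edge u w ∧ (u, w) ∉ e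
  edge_unique := by
    rintro _ _ _ ⟨u, w, rfl, rfl, h, he⟩ ⟨u', w', hu, rfl, h', he'⟩
    have h1 := F.part_above_of_exit h he hu
    rcases Relation.ReflTransGen.cases_head h1 with rfl | ⟨z, hz, _⟩
    · rw [F.edge_unique h h']
    · exact absurd (F.edge_unique h' hz.1 ▸ hz.2) he'
  acyclic := by
    intro C hC
    have key : ∀ C', Relation.TransGen (fun C C' : F.Block e =>
        ∃ u w, F.blockMk e u = C ∧ F.blockMk e w = C' ∧ F.edge u w ∧ (u, w) ∉ e) C C' →
        ∃ u w x, F.blockMk e u = C ∧ F.edge u w ∧ (u, w) ∉ e ∧ F.blockMk e x = C' ∧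
          Relation.TransGen F.edge u x := by
      intro C' h
      induction h with
      | single h =>
        obtain ⟨u, w, hu, hw, h, he⟩ := h
        exact ⟨u, w, w, hu, h, he, hw, .single h⟩
      | tail _ h ih =>
        obtain ⟨u, w, x, hu, huw, he, hx, hux⟩ := ih
        obtain ⟨u', w', hu', hw', h', he'⟩ := h
        have hxu' := F.part_above_of_exit h' he' (hx.trans hu'.symm)
        refine ⟨u, w, w', hu, huw, he, hw', ?_⟩
        exact (hux.trans_left (Relation.ReflTransGen.mono (fun _ _ h => h.1) _ _ hxu')).tail h'
    obtain ⟨u, w, x, hu, huw, he, hx, hux⟩ := key C hC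
    have hxu := F.part_above_of_exit huw he (hx.trans hu.symm)
    exact F.acyclic u (hux.trans_left (Relation.ReflTransGen.mono (fun _ _ h => h.1) _ _ hxu))

/-! ### Linear orders -/

/-- Linear orders on a (nonempty, finite) rooted forest: bijections `σ` from the vertices to
`{0, …, n - 1}` such that `a ↠ b` implies `σ a ≥ σ b`. -/
def LinOrder (F : RootedForest V) : Type _ :=
  {σ : V ≃ Fin (Nat.card V) // ∀ a b, F.Above a b → σ b ≤ σ a}

instance (F : RootedForest V) [Finite V] : Fintype F.LinOrder :=
  @Fintype.ofFinite _ (inferInstanceAs (Finite {_σ : V ≃ Fin (Nat.card V) // _}))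

end RootedForest

/-! ## Decorated forests and their isomorphism classes -/

/-- A rooted forest with its vertices decorated by `D`. -/
structure DecForest (V D : Type*) extends RootedForest V where
  dec : V → D

namespace DecForest

variable {V W D : Type*}

/-- Pull a decorated forest back along an injective map. -/
def comap (F : DecForest V D) (f : W ↪ V) : DecForest W D :=
  { F.toRootedForest.comap f with dec := F.dec ∘ f }

/-- The decorated forest on a set `S` of vertices. -/
def induce (F : DecForest V D) (S : Set V) : DecForest S D :=
  F.comap (Function.Embedding.subtype (· ∈ S))

/-- `Part_e(F)`, with the same decorations. -/
def part (F : DecForest V D) (e : Set (V × V)) : DecForest V D :=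
  { F.toRootedForest.part e with dec := F.dec }

/-- Disjoint union of decorated forests. -/
def sum (F : DecForest V D) (G : DecForest W D) : DecForest (V ⊕ W) D :=
  { F.toRootedForest.sum G.toRootedForest with dec := Sum.elim F.dec G.dec }

/-- Isomorphism of decorated rooted forests. -/
def Isom (F : DecForest V D) (G : DecForest W D) : Prop :=
  ∃ f : V ≃ W, (∀ u v, G.edge (f u) (f v) ↔ F.edge u v) ∧ ∀ v, G.dec (f v) = F.dec v

theorem Isom.refl (F : DecForest V D) : F.Isom F := ⟨Equiv.refl V, by simp, by simp⟩

theorem Isom.symm {F : DecForest V D} {G : DecForest W D} (h : F.Isom G) : G.Isom F := by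
  obtain ⟨f, h, h'⟩ := h
  refine ⟨f.symm, fun u v => ?_, fun v => ?_⟩
  · rw [← h]; simp
  · rw [← h']; simp

theorem Isom.trans {X : Type*} {F : DecForest V D} {G : DecForest W D} {H : DecForest X D}
    (h : F.Isom G) (k : G.Isom H) : F.Isom H := by
  obtain ⟨f, h, h'⟩ := h
  obtain ⟨g, k, k'⟩ := k
  exact ⟨f.trans g, fun u v => by simp [k, h], fun v => by simp [k', h']⟩

theorem isom_comap_equiv (F : DecForest V D) (f : W ≃ V) : (F.comap f.toEmbedding).Isom F :=
  ⟨f, fun _ _ => Iff.rfl, fun _ => rfl⟩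

theorem Isom.sum {V' W' : Type*} {F : DecForest V D} {G : DecForest W D}
    {F' : DecForest V' D} {G' : DecForest W' D} (h : F.Isom F') (k : G.Isom G') :
    (F.sum G).Isom (F'.sum G') := by
  obtain ⟨f, h, h'⟩ := h
  obtain ⟨g, k, k'⟩ := k
  refine ⟨f.sumCongr g, ?_, ?_⟩
  · rintro (u | u) (v | v) <;> simp [DecForest.sum, RootedForest.sum, h, k]
  · rintro (u | u) <;> simp [DecForest.sum, h', k']

/-- A relation-preserving bijection carries connectedness. -/
theorem Isom.isTree {F : DecForest V D} {G : DecForest W D} (h : F.Isom G)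
    (hF : F.IsTree) : G.IsTree := by
  obtain ⟨f, h, _⟩ := h
  have i : F.graph ≃g G.graph :=
    ⟨f, by intro a b; simp [RootedForest.graph, SimpleGraph.fromRel_adj, h]⟩
  exact i.connected_iff.1 hF

end DecForest

/-- The setoid of isomorphic decorated forests with vertex set `{0, …, n - 1}`, `n ≥ 0`. -/
def forestSetoid (D : Type*) : Setoid (Σ n : ℕ, DecForest (Fin n) D) where
  r F G := F.2.Isom G.2
  iseqv := ⟨fun F => .refl F.2, fun h => h.symm, fun h k => h.trans k⟩

/-- The set of (isomorphism classes of) finite rooted forests with vertices decorated by `D`. -/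
def ForestClass (D : Type*) : Type _ := Quotient (forestSetoid D)

namespace ForestClass

variable {V W D : Type*}

/-- The isomorphism class of a decorated forest on an arbitrary finite set of vertices. -/
def mk [Finite V] (F : DecForest V D) : ForestClass D :=
  Quotient.mk (forestSetoid D) ⟨Nat.card V, F.comap (Finite.equivFin V).symm.toEmbedding⟩

theorem mk_eq_mk [Finite V] [Finite W] {F : DecForest V D} {G : DecForest W D} :
    mk F = mk G ↔ F.Isom G := by
  refine Quotient.eq.trans ⟨fun h => ?_, fun h => ?_⟩
  · exact ((F.isom_comap_equiv _).symm.trans h).trans (G.isom_comap_equiv _)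
  · exact ((F.isom_comap_equiv _).trans h).trans (G.isom_comap_equiv _).symm

theorem mk_fin {n : ℕ} (F : DecForest (Fin n) D) :
    mk F = Quotient.mk (forestSetoid D) ⟨n, F⟩ :=
  Quotient.sound (F.isom_comap_equiv _)

theorem exists_rep (c : ForestClass D) : ∃ (n : ℕ) (F : DecForest (Fin n) D), mk F = c := by
  induction c using Quotient.inductionOn with
  | h F => exact ⟨F.1, F.2, mk_fin F.2⟩

/-- The empty forest. -/
def emptyForest (D : Type*) : DecForest (Fin 0) D where
  edge _ _ := False
  edge_unique := by simp
  acyclic v := v.elim0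
  dec v := v.elim0

/-- The unit is the empty forest. -/
instance : One (ForestClass D) := ⟨mk (emptyForest D)⟩

/-- The product is the disjoint union. -/
instance : Mul (ForestClass D) :=
  ⟨Quotient.map₂ (fun F G => ⟨Nat.card (Fin F.1 ⊕ Fin G.1),
      (F.2.sum G.2).comap (Finite.equivFin _).symm.toEmbedding⟩)
    (fun _ _ h _ _ k => ((DecForest.isom_comap_equiv _ _).trans
      (DecForest.Isom.sum h k)).trans (DecForest.isom_comap_equiv _ _).symm)⟩

theorem mk_mul_mk [Finite V] [Finite W] (F : DecForest V D) (G : DecForest W D) :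
    mk F * mk G = mk (F.sum G) :=
  mk_eq_mk.2 ((F.isom_comap_equiv _).sum (G.isom_comap_equiv _))

instance : CommMonoid (ForestClass D) where
  mul_assoc a b c := by
    obtain ⟨n, F, rfl⟩ := exists_rep a
    obtain ⟨m, G, rfl⟩ := exists_rep b
    obtain ⟨k, H, rfl⟩ := exists_rep c
    simp only [mk_mul_mk]
    refine mk_eq_mk.2 ⟨Equiv.sumAssoc _ _ _, ?_, ?_⟩
    · rintro ((u | u) | u) ((v | v) | v) <;> simp [DecForest.sum, RootedForest.sum]
    · rintro ((u | u) | u) <;> simp [DecForest.sum]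
  one_mul a := by
    obtain ⟨n, F, rfl⟩ := exists_rep a
    refine (mk_mul_mk _ _).trans (mk_eq_mk.2 ⟨Equiv.emptySum _ _, ?_, ?_⟩)
    · rintro (u | u) (v | v)
      · exact u.elim0
      · exact u.elim0
      · exact v.elim0
      · simp [DecForest.sum, RootedForest.sum]
    · rintro (u | u)
      · exact u.elim0
      · simp [DecForest.sum]
  mul_one a := by
    obtain ⟨n, F, rfl⟩ := exists_rep a
    refine (mk_mul_mk _ _).trans (mk_eq_mk.2 ⟨Equiv.sumEmpty _ _, ?_, ?_⟩)
    · rintro (u | u) (v | v)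
      · simp [DecForest.sum, RootedForest.sum]
      · exact v.elim0
      · exact u.elim0
      · exact u.elim0
    · rintro (u | u)
      · simp [DecForest.sum]
      · exact u.elim0
  mul_comm a b := by
    obtain ⟨n, F, rfl⟩ := exists_rep a
    obtain ⟨m, G, rfl⟩ := exists_rep b
    simp only [mk_mul_mk]
    refine mk_eq_mk.2 ⟨Equiv.sumComm _ _, ?_, ?_⟩
    · rintro (u | u) (v | v) <;> simp [DecForest.sum, RootedForest.sum]
    · rintro (u | u) <;> simp [DecForest.sum]

/-- The isomorphism classes of nonempty trees among those of forests. -/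
def IsTree (c : ForestClass D) : Prop :=
  ∃ (n : ℕ) (F : DecForest (Fin n) D), F.IsTree ∧ mk F = c

end ForestClass

/-- The set of (isomorphism classes of) nonempty rooted trees with vertices decorated by `D`. -/
def TreeClass (D : Type*) : Type _ := {c : ForestClass D // c.IsTree}

/-- The isomorphism class of a decorated tree on an arbitrary finite set of vertices. -/
def TreeClass.mk {V D : Type*} [Finite V] (T : DecForest V D) (hT : T.IsTree) : TreeClass D :=
  ⟨ForestClass.mk T, _, _, (T.isom_comap_equiv (Finite.equivFin V).symm).symm.isTree hT,
    ForestClass.mk_fin _⟩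

/-! ## The Connes-Kreimer Hopf algebra of decorated rooted forests -/

section CK

variable (K D : Type*) [Field K]

/-- The vector space spanned by the decorated rooted forests, with the concatenation (disjoint
union) product. (A type synonym, because the coproduct is not the one for which the elements of the
monoid are group-like.) -/
def HCK : Type _ := MonoidAlgebra K (ForestClass D)

instance : CommRing (HCK K D) := inferInstanceAs (CommRing (MonoidAlgebra K (ForestClass D)))

instance : Algebra K (HCK K D) := inferInstanceAs (Algebra K (MonoidAlgebra K (ForestClass D)))

variable {D}

/-- The basis element of a forest. -/
def HCK.of (c : ForestClass D) : HCK K D := MonoidAlgebra.single c 1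

variable (D)

/-- Linear maps from the values on the basis of forests. -/
def HCK.linearLift {M : Type*} [AddCommGroup M] [Module K M] (f : ForestClass D → M) :
    HCK K D →ₗ[K] M :=
  (Finsupp.linearCombination K f).comp
    (MonoidAlgebra.coeffLinearEquiv K : MonoidAlgebra K (ForestClass D) ≃ₗ[K] _).toLinearMap

variable {D}

@[simp]
theorem HCK.linearLift_of {M : Type*} [AddCommGroup M] [Module K M] (f : ForestClass D → M)
    (c : ForestClass D) : HCK.linearLift K D f (HCK.of K c) = f c :=
  (Finsupp.linearCombination_single K 1 c).trans (one_smul K _)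

/-- The sum of `Lea_v(F) ⊗ Roo_v(F)` over the admissible cuts `v` of `F`. -/
def cutSum {V : Type*} [Finite V] (F : DecForest V D) : HCK K D ⊗[K] HCK K D :=
  ∑ v : F.AdmissibleCut,
    HCK.of K (.mk (F.induce v.lea)) ⊗ₜ[K] HCK.of K (.mk (F.induce v.roo))

theorem DecForest.Isom.induce {V W : Type*} {F : DecForest V D} {G : DecForest W D} (f : V ≃ W)
    (h : ∀ u v, G.edge (f u) (f v) ↔ F.edge u v) (h' : ∀ v, G.dec (f v) = F.dec v)
    {S : Set V} {S' : Set W} (hS : ∀ v, f v ∈ S' ↔ v ∈ S) : (F.induce S).Isom (G.induce S') :=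
  ⟨f.subtypeEquiv fun v => (hS v).symm, fun u v => h u v, fun v => h' v⟩

theorem RootedForest.above_iff {V W : Type*} {F : RootedForest V} {G : RootedForest W} (f : V ≃ W)
    (h : ∀ u v, G.edge (f u) (f v) ↔ F.edge u v) (u v : V) :
    G.Above (f u) (f v) ↔ F.Above u v := by
  refine ⟨fun k => ?_, fun k => Relation.ReflTransGen.lift f (fun a b => (h a b).2) _ _ k⟩
  have := Relation.ReflTransGen.lift (r := G.edge) (p := F.edge) f.symm
    (fun a b hab => (h _ _).1 (by simpa using hab)) _ _ k
  simpa [RootedForest.Above, Function.onFun] using this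

theorem cutSum_eq_of_isom {V W : Type*} [Finite V] [Finite W] {F : DecForest V D}
    {G : DecForest W D} (h : F.Isom G) : cutSum K F = cutSum K G := by
  obtain ⟨f, h, h'⟩ := h
  have ha := RootedForest.above_iff (F := F.toRootedForest) (G := G.toRootedForest) f h
  let E : F.AdmissibleCut ≃ G.AdmissibleCut :=
    (Equiv.Set.congr f).subtypeEquiv fun v => by
      change _ ↔ ∀ a ∈ f '' v, ∀ b ∈ f '' v, a ≠ b → ¬ G.Above a b
      simp only [Set.forall_mem_image, ha, ne_eq, f.injective.eq_iff]
  have hl : ∀ (v : F.AdmissibleCut) (w : V), f w ∈ (E v).lea ↔ w ∈ v.lea := by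
    intro v w
    change (∃ a ∈ f '' v.1, G.Above (f w) a) ↔ ∃ a ∈ v.1, F.Above w a
    simp only [Set.exists_mem_image, ha]
  refine Fintype.sum_equiv E _ _ fun v => ?_
  have h1 : ForestClass.mk (F.induce v.lea) = .mk (G.induce (E v).lea) :=
    ForestClass.mk_eq_mk.2 (.induce f h h' (hl v))
  have h2 : ForestClass.mk (F.induce v.roo) = .mk (G.induce (E v).roo) :=
    ForestClass.mk_eq_mk.2 (.induce f h h' fun w => not_congr (hl v w))
  rw [h1, h2]

/-- The cut coproduct of a forest (well defined on isomorphism classes). -/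
def cutCoproduct : ForestClass D → HCK K D ⊗[K] HCK K D :=
  Quotient.lift (fun F => cutSum K F.2) fun _ _ h => cutSum_eq_of_isom K h

open Classical in
/-- The cut coproduct, and the counit that is `1` at the empty forest and `0` at the others. -/
instance : CoalgebraStruct K (HCK K D) where
  comul := HCK.linearLift K D (cutCoproduct K)
  counit := HCK.linearLift K D fun c => if c = 1 then 1 else 0

/-- The inclusion of the span of the nonempty trees. -/
def treeIncl : (TreeClass D →₀ K) →ₗ[K] HCK K D :=
  Finsupp.linearCombination K fun t => HCK.of K t.1

end CK

/-! ## The shuffle Hopf algebra -/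

section Sh

variable (K D : Type*) [Field K]

/-- The vector space spanned by the `D`-words (with the shuffle product, defined below). -/
def Sh : Type _ := List D →₀ K

instance : AddCommGroup (Sh K D) := inferInstanceAs (AddCommGroup (List D →₀ K))

instance : Module K (Sh K D) := inferInstanceAs (Module K (List D →₀ K))

namespace Sh

variable {D}

/-- The basis element of a word. -/
def word (w : List D) : Sh K D := Finsupp.single w (1 : K)

variable {K}

/-- Linear maps from the values on the basis of words. -/
def linearLift {M : Type*} [AddCommGroup M] [Module K M] (f : List D → M) : Sh K D →ₗ[K] M :=
  Finsupp.linearCombination K f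

@[simp]
theorem linearLift_word {M : Type*} [AddCommGroup M] [Module K M] (f : List D → M) (w : List D) :
    linearLift f (word K w) = f w :=
  (Finsupp.linearCombination_single K 1 w).trans (one_smul K _)

theorem hom_ext {M : Type*} [AddCommGroup M] [Module K M] {f g : Sh K D →ₗ[K] M}
    (h : ∀ w, f (word K w) = g (word K w)) : f = g :=
  Finsupp.lhom_ext' (M := K) fun w => LinearMap.ext_ring (h w)

/-- Put the letter `a` in front of each word. -/
def cons (a : D) : Sh K D →ₗ[K] Sh K D := linearLift fun w => word K (a :: w)

@[simp]
theorem cons_word (a : D) (w : List D) : cons a (word K w) = word K (a :: w) := by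
  simp [cons]

variable (K) in
/-- The shuffle of two words: the sum, over all the ways to interleave them, of the words so
obtained. The first letter comes from one of the two words. -/
def shuffle : List D → List D → Sh K D
  | [], v => word K v
  | a :: u, [] => word K (a :: u)
  | a :: u, b :: v => cons a (shuffle u (b :: v)) + cons b (shuffle (a :: u) v)
termination_by u v => u.length + v.length

/-- The shuffle product as a bilinear map. -/
def mulLin : Sh K D →ₗ[K] Sh K D →ₗ[K] Sh K D :=
  linearLift fun u => linearLift fun v => shuffle K u v

@[simp]
theorem mulLin_word (u v : List D) : mulLin (word K u) (word K v) = shuffle K u v := by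
  simp [mulLin]

@[simp] theorem shuffle_nil_left (v : List D) : shuffle K [] v = word K v := by
  simp [shuffle]

@[simp] theorem shuffle_nil_right (u : List D) : shuffle K u [] = word K u := by
  cases u <;> simp [shuffle]

theorem mulLin_one_left (x : Sh K D) : mulLin (word K []) x = x := by
  have : mulLin (K := K) (word K ([] : List D)) = LinearMap.id := hom_ext (by simp)
  rw [this]; rfl

theorem mulLin_one_right (x : Sh K D) : mulLin x (word K []) = x := by
  have : (mulLin (K := K) (D := D)).flip (word K []) = LinearMap.id := hom_ext (by simp)
  exact LinearMap.congr_fun this x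

theorem mulLin_cons_cons (a b : D) (x y : Sh K D) :
    mulLin (cons a x) (cons b y) =
      cons a (mulLin x (cons b y)) + cons b (mulLin (cons a x) y) := by
  have : (mulLin (K := K)).compl₁₂ (cons a) (cons b) =
      (mulLin.compl₁₂ LinearMap.id (cons b)).compr₂ (cons a) +
        (mulLin.compl₁₂ (cons a) LinearMap.id).compr₂ (cons b) := by
    refine hom_ext fun u => hom_ext fun v => ?_
    simp [shuffle]
  exact LinearMap.congr_fun₂ this x y

theorem shuffle_comm (u v : List D) : shuffle K u v = shuffle K v u := by
  match u, v with
  | [], v => simp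
  | a :: u, [] => simp
  | a :: u, b :: v =>
    rw [shuffle, shuffle, shuffle_comm u (b :: v), shuffle_comm (a :: u) v, add_comm]
termination_by u.length + v.length

theorem mulLin_assoc_word (u v w : List D) :
    mulLin (mulLin (word K u) (word K v)) (word K w) =
      mulLin (word K u) (mulLin (word K v) (word K w)) := by
  match u, v, w with
  | [], v, w => rw [mulLin_one_left, mulLin_one_left]
  | a :: u, [], w => rw [mulLin_one_left, mulLin_one_right]
  | a :: u, b :: v, [] => rw [mulLin_one_right, mulLin_one_right]
  | a :: u, b :: v, c :: w =>
    have h1 := mulLin_assoc_word u (b :: v) (c :: w)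
    have h2 := mulLin_assoc_word (a :: u) v (c :: w)
    have h3 := mulLin_assoc_word (a :: u) (b :: v) w
    simp only [← cons_word] at h1 h2 h3 ⊢
    simp only [mulLin_cons_cons, map_add, LinearMap.add_apply] at h1 h2 h3 ⊢
    rw [h1, h2, ← h3]
    simp only [map_add]
    abel
termination_by u.length + v.length + w.length

theorem mulLin_comm (x y : Sh K D) : mulLin x y = mulLin y x := by
  have : mulLin (K := K) (D := D) = mulLin.flip :=
    hom_ext fun u => hom_ext fun v => by simp [shuffle_comm u v]
  exact LinearMap.congr_fun₂ this x y

theorem mulLin_assoc (x y z : Sh K D) : mulLin (mulLin x y) z = mulLin x (mulLin y z) := by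
  have hw : ∀ u v : List D, mulLin (mulLin (word K u) (word K v)) =
      (mulLin (word K u)).comp (mulLin (word K v)) := fun u v =>
    hom_ext fun w => mulLin_assoc_word u v w
  have hv : ∀ u : List D, mulLin.comp (mulLin (word K u)) =
      (LinearMap.llcomp K _ _ _ (mulLin (word K u))).comp mulLin := fun u =>
    hom_ext fun v => hw u v
  have hu : (mulLin.compr₂ mulLin).flip y =
      (LinearMap.llcomp K _ _ _).flip (mulLin y) ∘ₗ mulLin :=
    hom_ext fun u => LinearMap.congr_fun (hv u) y
  exact LinearMap.congr_fun (LinearMap.congr_fun hu x) z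

variable (K D)

/-- `Sh` with the shuffle product; the unit is the empty word. -/
instance : CommRing (Sh K D) :=
  { (inferInstance : AddCommGroup (Sh K D)) with
    mul := fun x y => mulLin x y
    one := word K []
    mul_assoc := mulLin_assoc
    mul_comm := mulLin_comm
    one_mul := mulLin_one_left
    mul_one := mulLin_one_right
    zero_mul := fun x => LinearMap.map_zero₂ mulLin x
    mul_zero := fun x => map_zero (mulLin x)
    left_distrib := fun x y z => map_add (mulLin x) y z
    right_distrib := fun x y z => LinearMap.map_add₂ mulLin x y z }

instance : Algebra K (Sh K D) :=
  Algebra.ofModule (fun c x y => LinearMap.map_smul₂ mulLin c x y)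
    (fun c x y => map_smul (mulLin x) c y)

/-- The deconcatenation coproduct `(v₁…vₙ) ↦ ∑ᵢ (v₁…vᵢ) ⊗ (vᵢ₊₁…vₙ)`, `0 ≤ i ≤ n`, and the counit
that is `1` at the empty word and `0` at the others. -/
instance : CoalgebraStruct K (Sh K D) where
  comul := linearLift fun w =>
    ∑ i ∈ Finset.range (w.length + 1), word K (w.take i) ⊗ₜ[K] word K (w.drop i)
  counit := linearLift fun w => if w.isEmpty then 1 else 0

/-- The projection `π` onto the words of length `1`, killing all the other words. -/
def proj : Sh K D →ₗ[K] (D →₀ K) :=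
  linearLift fun w => match w with
    | [d] => Finsupp.single d 1
    | _ => 0

variable {K D}

/-- The element `x₁ ⋯ xₙ` of the tensor module over the vector space spanned by `D`, seen as a
linear combination of words: the multilinear extension of `(d₁, …, dₙ) ↦ (d₁…dₙ)`. -/
def tensorWord : List (D →₀ K) → Sh K D
  | [] => word K []
  | x :: l => x.sum fun d c => c • cons d (tensorWord l)

end Sh

/-! ## The combinatorial formula -/

variable {K D}

/-- The diagram that characterizes `Φ`: `π ∘ Φ ∘ i = φ`. -/
def Extends (φ : (TreeClass D →₀ K) →ₗ[K] (D →₀ K)) (Φ : HCK K D →ₐc[K] Sh K D) : Prop :=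
  ∀ x : TreeClass D →₀ K, Sh.proj K D (Φ (treeIncl K x)) = φ x

/-- A connected component of `Part_e(F)` is a tree. -/
theorem DecForest.isTree_block {V : Type*} (F : DecForest V D) (e : Set (V × V))
    (C : F.Block e) : ((F.part e).induce C.supp).IsTree := by
  have h : ((F.part e).induce C.supp).graph = (F.part e).graph.induce C.supp := by
    ext a b
    exact and_congr_left' (not_congr Subtype.ext_iff)
  have := C.connected_toSimpleGraph
  unfold RootedForest.IsTree
  rw [h]
  exact this

/-- The connected component `C` of `Part_e(F)` as a decorated tree. -/
def DecForest.blockTree {V : Type*} [Finite V] (F : DecForest V D) (e : Set (V × V))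
    (C : F.Block e) : TreeClass D :=
  TreeClass.mk ((F.part e).induce C.supp) (F.isTree_block e C)

/-- The word `φ(σ⁻¹(max)) ⋯ φ(σ⁻¹(min))` of a contraction `e` and a linear order `σ` on
`Cont_e(F)`, where `σ⁻¹(i)` is seen as a connected component of `Part_e(F)`. -/
def orderWord {V : Type*} [Finite V] (φ : (TreeClass D →₀ K) →ₗ[K] (D →₀ K))
    (F : DecForest V D) (e : Set (V × V)) (σ : (F.cont e).LinOrder) : Sh K D :=
  Sh.tensorWord <| List.ofFn fun i : Fin (Nat.card (F.Block e)) =>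
    φ (Finsupp.single (F.blockTree e (σ.1.symm i.rev)) 1)

end Sh

end CKShuffle

end

/-! The argument describes the morphism by the first letters of its words. For a vertex v let `F.up
v` be the set of vertices above v. The candidate Φ satisfies Φ(1) = 1 and, for a nonempty forest F,
Φ(F) = ∑_v φ(F.up v) · Φ(F \ F.up v), where · is concatenation and φ is extended by zero to forests
that are not trees (`forestImage_mk`).

To connect this recursion with contractions, a contraction with a linear order is encoded as a
layering: a numbering of the vertices that weakly decreases along the edges and whose fibres are
nonempty trees. The last fibre is up-closed and rooted, hence equal to `F.up v` for a unique v, and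
removing it leaves a layering of the rest (`Layering.snoc_bijective`). Since words list the last
fibre first, the sum over all layerings obeys the recursion; `LinOrder.layering_bijective`
identifies it with the sum in the formula.

Existence: the recursion has the same shape as the first-letter rules for the shuffle product
(`Sh.lcons_mul_lcons`) and for deconcatenation (`Sh.comul_lcons`). Induction on the number of
vertices then gives compatibility with products and coproducts, once admissible cuts are replaced by
up-closed sets of vertices.

Uniqueness: an element x of the shuffle algebra is recovered as ε(x)1 + ∑ π(x′)·x″
(`Sh.eq_counit_add_lcons_proj`). For any Φ extending φ, the map π ∘ Φ is φ on trees and vanishes on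
all other forests, because π is an infinitesimal character. In the coproduct of F only the up-closed
sets `F.up v` are trees, so Φ satisfies the same recursion and equals the candidate. -/

namespace CKShuffle

/-! ### The shuffle algebra through first letters -/

section

namespace Sh

variable {K D : Type*} [Field K]

/-- Concatenation of a linear combination of letters with a linear combination of words. -/
noncomputable def lcons : (D →₀ K) →ₗ[K] Sh K D →ₗ[K] Sh K D :=
  Finsupp.linearCombination K fun d => cons d

@[simp]
theorem lcons_single (d : D) (c : K) : lcons (Finsupp.single d c) = c • cons d := by
  simp [lcons]

theorem tensorWord_cons (x : D →₀ K) (l : List (D →₀ K)) :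
    tensorWord (x :: l) = lcons x (tensorWord l) := by
  simp [tensorWord, lcons, Finsupp.linearCombination_apply, Finsupp.sum, LinearMap.sum_apply]

theorem one_def : (1 : Sh K D) = word K [] := rfl

theorem mul_def (x y : Sh K D) : x * y = mulLin x y := rfl

/-- The recursive rule defining the shuffle of two words is linear in both first letters, so it
survives replacing letters by linear combinations. Multiplicativity of the morphism rests on this
rule. -/
theorem lcons_mul_lcons (x y : D →₀ K) (a b : Sh K D) :
    lcons x a * lcons y b = lcons x (a * lcons y b) + lcons y (lcons x a * b) := by
  induction x using Finsupp.induction_linear with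
  | zero => simp
  | add x₁ x₂ h₁ h₂ => simp only [map_add, LinearMap.add_apply, add_mul, h₁, h₂]; abel
  | single d c =>
    induction y using Finsupp.induction_linear with
    | zero => simp
    | add y₁ y₂ h₁ h₂ => simp only [map_add, LinearMap.add_apply, mul_add, h₁, h₂]; abel
    | single d' c' =>
      simp only [map_smul, lcons_single, LinearMap.smul_apply, smul_mul_assoc, mul_smul_comm,
        mul_def, mulLin_cons_cons, smul_add]
      rw [smul_comm c c' (cons d' _)]

@[simp]
theorem counit_word (w : List D) :
    Coalgebra.counit (R := K) (word K w) = if w.isEmpty then (1 : K) else 0 :=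
  linearLift_word _ w

theorem comul_word (w : List D) : CoalgebraStruct.comul (R := K) (word K w) =
    ∑ i ∈ Finset.range (w.length + 1), word K (w.take i) ⊗ₜ[K] word K (w.drop i) :=
  linearLift_word _ w

theorem comul_one : CoalgebraStruct.comul (R := K) (1 : Sh K D) = 1 ⊗ₜ[K] 1 := by
  simp [one_def, comul_word]

/-- The empty prefix gives the first term; every other prefix begins with `d`, and deleting this
letter gives a prefix of `y`. -/
theorem comul_cons (d : D) (y : Sh K D) : CoalgebraStruct.comul (R := K) (cons d y) =
    1 ⊗ₜ[K] cons d y + (cons d).rTensor (Sh K D) (CoalgebraStruct.comul (R := K) y) := by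
  have : (CoalgebraStruct.comul (R := K)).comp (cons d) =
      (TensorProduct.mk K _ _ (1 : Sh K D)).comp (cons d) +
        ((cons d).rTensor (Sh K D)).comp (CoalgebraStruct.comul (R := K)) := by
    refine hom_ext fun w => ?_
    simp [comul_word, Finset.sum_range_succ' _ (List.length w + 1), one_def,
      add_comm (word K [] ⊗ₜ[K] _)]
  exact LinearMap.congr_fun this y

theorem comul_lcons (x : D →₀ K) (y : Sh K D) :
    CoalgebraStruct.comul (R := K) (lcons x y) =
      1 ⊗ₜ[K] lcons x y + (lcons x).rTensor (Sh K D) (CoalgebraStruct.comul (R := K) y) := by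
  induction x using Finsupp.induction_linear with
  | zero => simp
  | add x₁ x₂ h₁ h₂ =>
    simp only [map_add, LinearMap.add_apply, h₁, h₂, TensorProduct.tmul_add,
      LinearMap.rTensor_add]
    abel
  | single d c =>
    simp only [map_smul, lcons_single, LinearMap.smul_apply, comul_cons, LinearMap.rTensor_smul,
      smul_add, TensorProduct.tmul_smul]

theorem counit_cons (d : D) (y : Sh K D) : Coalgebra.counit (R := K) (cons d y) = 0 := by
  have : (Coalgebra.counit (R := K)).comp (cons (K := K) d) = 0 := hom_ext fun w => by simp
  exact LinearMap.congr_fun this y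

theorem counit_lcons (x : D →₀ K) (y : Sh K D) : Coalgebra.counit (R := K) (lcons x y) = 0 := by
  simp [lcons, Finsupp.linearCombination_apply, Finsupp.sum, LinearMap.sum_apply, counit_cons]

@[simp]
theorem counit_one : Coalgebra.counit (R := K) (1 : Sh K D) = 1 := by
  simp [one_def]

theorem proj_one : proj K D 1 = 0 := linearLift_word _ _

theorem proj_cons (d : D) (y : Sh K D) :
    proj K D (cons d y) = Coalgebra.counit (R := K) y • Finsupp.single d 1 := by
  have : (proj K D).comp (cons d) =
      (Coalgebra.counit (R := K)).smulRight (Finsupp.single d (1 : K)) := by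
    refine hom_ext fun w => ?_
    cases w <;> simp [proj]
  exact LinearMap.congr_fun this y

theorem proj_lcons (x : D →₀ K) (y : Sh K D) :
    proj K D (lcons x y) = Coalgebra.counit (R := K) y • x := by
  induction x using Finsupp.induction_linear with
  | zero => simp
  | add x₁ x₂ h₁ h₂ => simp only [map_add, LinearMap.add_apply, h₁, h₂, smul_add]
  | single d c =>
    simp [proj_cons, mul_comm]

theorem counit_shuffle_cons_right (u v : List D) (b : D) :
    Coalgebra.counit (R := K) (shuffle K u (b :: v)) = 0 := by
  cases u <;> simp [shuffle, counit_cons]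

theorem counit_shuffle_cons_left (u v : List D) (a : D) :
    Coalgebra.counit (R := K) (shuffle K (a :: u) v) = 0 := by
  rw [shuffle_comm, counit_shuffle_cons_right]

/-- The projection onto the letters is an infinitesimal character. -/
theorem proj_mul (x y : Sh K D) : proj K D (x * y) =
    Coalgebra.counit (R := K) x • proj K D y + Coalgebra.counit (R := K) y • proj K D x := by
  have : mulLin.compr₂ (proj K D) =
      (LinearMap.lsmul K _).compl₁₂ (Coalgebra.counit (R := K)) (proj K D) +
      ((LinearMap.lsmul K _).compl₁₂ (Coalgebra.counit (R := K)) (proj K D)).flip := by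
    refine hom_ext fun u => hom_ext fun v => ?_
    have h := proj_one (K := K) (D := D)
    rw [one_def] at h
    rcases u with - | ⟨a, u⟩
    · simp [h]
    rcases v with - | ⟨b, v⟩
    · simp [h]
    simp [shuffle, proj_cons, counit_shuffle_cons_right, counit_shuffle_cons_left]
  exact LinearMap.congr_fun₂ this x y

/-- An element is determined by its counit and the part of its coproduct with a letter on the
left. -/
theorem eq_counit_add_lcons_proj (x : Sh K D) : x = Coalgebra.counit (R := K) x • 1 +
    TensorProduct.lift (lcons.comp (proj K D)) (CoalgebraStruct.comul (R := K) x) := by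
  have : LinearMap.id = (Coalgebra.counit (R := K)).smulRight (1 : Sh K D) +
    (TensorProduct.lift (lcons.comp (proj K D))).comp (CoalgebraStruct.comul (R := K)) := by
    refine hom_ext fun w => ?_
    rcases w with - | ⟨a, w⟩
    · have := proj_one (K := K) (D := D)
      rw [one_def] at this
      simp [comul_word, one_def, this]
    -- On a left factor that starts with `a`, the projection sees only the multiple of the
    -- one-letter word `a`, so the tail of that factor enters through its counit.
    · have h : ∀ v, (TensorProduct.lift (lcons.comp (proj K D)))
          ((cons a).rTensor (Sh K D) v) = cons a
            (TensorProduct.lift ((LinearMap.lsmul K _).comp (Coalgebra.counit (R := K))) v) := by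
        intro v
        induction v with
        | zero => simp
        | add v₁ v₂ h₁ h₂ => simp only [map_add, h₁, h₂]
        | tmul x y => simp [proj_cons]
      -- The counit axiom for deconcatenation: only the empty prefix contributes.
      have h' : TensorProduct.lift ((LinearMap.lsmul K _).comp (Coalgebra.counit (R := K)))
          (CoalgebraStruct.comul (R := K) (word K w)) = word K w := by
        rw [comul_word, Finset.sum_range_succ']
        simp only [map_add, map_sum]
        rw [Finset.sum_eq_zero]
        · simp
        · intro i hi
          have : i < w.length := by simpa using hi
          rcases w with - | ⟨b, w⟩
          · simp at this
          · simp
      simp only [LinearMap.id_apply, LinearMap.add_apply, LinearMap.smulRight_apply,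
        LinearMap.comp_apply, counit_word]
      rw [← cons_word, comul_cons, map_add, h, h']
      simp [proj_one]
  exact LinearMap.congr_fun this x

end Sh

end

/-! ### Up-closed sets of vertices, rooted sets and admissible cuts -/

section

namespace RootedForest

variable {V W : Type*}

/-- The vertices above a vertex. -/
def up (F : RootedForest V) (v : V) : Set V := {x | F.Above x v}

theorem mem_up_self (F : RootedForest V) (v : V) : v ∈ F.up v := Relation.ReflTransGen.refl

theorem above_antisymm (F : RootedForest V) {u v : V} (h : F.Above u v) (k : F.Above v u) :
    u = v := by
  rcases Relation.reflTransGen_iff_eq_or_transGen.1 h with rfl | h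
  · rfl
  · exact absurd (h.trans_left k) (F.acyclic u)

theorem up_injective (F : RootedForest V) : Function.Injective F.up := fun u v h =>
  F.above_antisymm (h ▸ F.mem_up_self u : u ∈ F.up v) (h ▸ F.mem_up_self v : v ∈ F.up u)

/-- Sets of vertices that are closed under passing to a vertex above. -/
def IsUp (F : RootedForest V) (U : Set V) : Prop := ∀ a b, F.edge a b → b ∈ U → a ∈ U

theorem IsUp.mem_of_above {F : RootedForest V} {U : Set V} (hU : F.IsUp U) {a b : V}
    (h : F.Above a b) (hb : b ∈ U) : a ∈ U := by
  induction h using Relation.ReflTransGen.head_induction_on with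
  | refl => exact hb
  | head h _ ih => exact hU _ _ h ih

theorem isUp_up (F : RootedForest V) (v : V) : F.IsUp (F.up v) := fun _ _ h k =>
  Relation.ReflTransGen.head h k

theorem IsUp.up_subset {F : RootedForest V} {U : Set V} (hU : F.IsUp U) {v : V} (hv : v ∈ U) :
    F.up v ⊆ U := fun _ h => hU.mem_of_above h hv

/-- Finiteness and acyclicity let induction run from the roots upwards: the hypothesis at a vertex
concerns the target of its outgoing edge. -/
theorem wellFounded_edge [Finite V] (F : RootedForest V) :
    WellFounded fun a b => F.edge b a := by
  have : Std.Irrefl (Function.swap (Relation.TransGen F.edge)) := ⟨F.acyclic⟩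
  have : IsTrans V (Function.swap (Relation.TransGen F.edge)) := ⟨fun _ _ _ h k => k.trans h⟩
  exact Subrelation.wf (fun h => Relation.TransGen.single h)
    (Finite.wellFounded_of_trans_of_irrefl (Function.swap (Relation.TransGen F.edge)))

/-- Each nonempty set of vertices has an element whose outgoing edge leaves it. -/
theorem exists_exit [Finite V] (F : RootedForest V) {S : Set V} (hS : S.Nonempty) :
    ∃ r ∈ S, ∀ b, F.edge r b → b ∉ S := by
  obtain ⟨r, hr, h⟩ := F.wellFounded_edge.has_min S hS
  exact ⟨r, hr, fun b hb hbS => h b hbS hb⟩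

/-- A set of vertices spans a tree: every element but one has its outgoing edge in the set. -/
def IsRooted (F : RootedForest V) (S : Set V) : Prop :=
  ∃ r ∈ S, ∀ x ∈ S, x ≠ r → ∃ y ∈ S, F.edge x y

theorem IsRooted.above [Finite V] {F : RootedForest V} {S : Set V} {r : V}
    (h : ∀ x ∈ S, x ≠ r → ∃ y ∈ S, F.edge x y) {x : V} (hx : x ∈ S) : F.Above x r := by
  induction x using F.wellFounded_edge.induction with
  | h x ih =>
    by_cases e : x = r
    · exact e ▸ .refl
    · obtain ⟨y, hy, hxy⟩ := h x hx e
      exact (ih y hxy hy).head hxy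

theorem isRooted_up (F : RootedForest V) (v : V) : F.IsRooted (F.up v) := by
  refine ⟨v, F.mem_up_self v, fun x hx e => ?_⟩
  rcases Relation.ReflTransGen.cases_head hx with rfl | ⟨y, hy, h⟩
  · exact absurd rfl e
  · exact ⟨y, h, hy⟩

/-- A rooted set of vertices that is closed under passing to a vertex above. -/
theorem IsRooted.exists_eq_up [Finite V] {F : RootedForest V} {S : Set V} (h : F.IsRooted S)
    (hS : F.IsUp S) : ∃ v, S = F.up v := by
  obtain ⟨r, hr, h⟩ := h
  exact ⟨r, Set.Subset.antisymm (fun x hx => IsRooted.above h hx) (hS.up_subset hr)⟩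

theorem isRooted_induce_iff (F : RootedForest V) (S : Set V) (T : Set S) :
    (F.induce S).IsRooted T ↔ F.IsRooted (Subtype.val '' T) := by
  constructor
  · rintro ⟨r, hr, h⟩
    refine ⟨r, ⟨r, hr, rfl⟩, ?_⟩
    rintro _ ⟨x, hx, rfl⟩ hxr
    obtain ⟨y, hy, hxy⟩ := h x hx fun e => hxr (e ▸ rfl)
    exact ⟨y, ⟨y, hy, rfl⟩, hxy⟩
  · rintro ⟨_, ⟨r, hr, rfl⟩, h⟩
    refine ⟨r, hr, fun x hx hxr => ?_⟩
    obtain ⟨_, ⟨y, hy, rfl⟩, hxy⟩ := h x ⟨x, hx, rfl⟩ fun e => hxr (Subtype.ext e)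
    exact ⟨y, hy, hxy⟩

theorem isRooted_iff_of_equiv {F : RootedForest V} {G : RootedForest W} (f : V ≃ W)
    (h : ∀ u v, G.edge (f u) (f v) ↔ F.edge u v) (S : Set W) :
    F.IsRooted (f ⁻¹' S) ↔ G.IsRooted S := by
  simp [IsRooted, ← f.exists_congr_right, ← f.forall_congr_right, h]

/-- Take `r` without outgoing edge. Connectedness gives a common vertex below `x` and `r`, and
nothing but `r` lies below `r`. -/
theorem IsTree.exists_above [Finite V] {F : RootedForest V} (h : F.IsTree) :
    ∃ r, ∀ x, F.Above x r := by
  obtain ⟨r, -, hr⟩ := F.exists_exit (S := Set.univ) ⟨h.nonempty.some, trivial⟩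
  refine ⟨r, fun x => ?_⟩
  obtain ⟨y, hxy, hry⟩ := F.exists_above_above_of_reachable (h.preconnected x r)
  rcases Relation.ReflTransGen.cases_head hry with rfl | ⟨z, hz, _⟩
  · exact hxy
  · exact absurd trivial (hr z hz)

theorem isTree_of_above {F : RootedForest V} {r : V} (h : ∀ x, F.Above x r) : F.IsTree := by
  have key : ∀ x y, F.Above x y → F.graph.Reachable x y := by
    intro x y hxy
    induction hxy with
    | refl => exact .refl _
    | @tail b c _ hbc ih =>
      refine ih.trans (SimpleGraph.Adj.reachable ⟨fun e => ?_, .inl hbc⟩)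
      exact F.acyclic b (.single (by rwa [← e] at hbc))
  have : Nonempty V := ⟨r⟩
  exact ⟨fun x y => (key x r (h x)).trans (key y r (h y)).symm⟩

theorem above_of_induce (F : RootedForest V) {S : Set V} {a b : S} (h : (F.induce S).Above a b) :
    F.Above a b :=
  Relation.ReflTransGen.lift Subtype.val (fun _ _ h => h) _ _ h

/-- In an up-closed set the vertices above a vertex are the same as in the whole forest. -/
theorem IsUp.induce_up {F : RootedForest V} {U : Set V} (hU : F.IsUp U) (v : U) :
    Subtype.val '' (F.induce U).up v = F.up v := by
  ext x
  constructor
  · rintro ⟨x, hx, rfl⟩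
    exact F.above_of_induce hx
  · intro hx
    suffices ∀ h : x ∈ U, (F.induce U).Above ⟨x, h⟩ v from
      ⟨⟨x, hU.mem_of_above hx v.2⟩, this _, rfl⟩
    change F.Above x v at hx
    induction hx using Relation.ReflTransGen.head_induction_on with
    | refl => exact fun _ => .refl
    | @head a b h k ih =>
      have hb := hU.mem_of_above k v.2
      exact fun ha => Relation.ReflTransGen.head
        (show (F.induce U).edge ⟨a, ha⟩ ⟨b, hb⟩ from h) (ih hb)

/-- The only trees among the up-closed sets are the sets of vertices above a given one. -/
theorem IsUp.exists_eq_up_of_isTree [Finite V] {F : RootedForest V} {U : Set V} (hU : F.IsUp U)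
    (h : (F.induce U).IsTree) : ∃ v, U = F.up v := by
  obtain ⟨r, hr⟩ := h.exists_above
  exact ⟨r, Set.Subset.antisymm (fun x hx => F.above_of_induce (hr ⟨x, hx⟩))
    (hU.up_subset r.2)⟩

/-- The finite set of up-closed sets of vertices. -/
noncomputable def upSets (F : RootedForest V) [Finite V] : Finset (Set V) :=
  (Set.toFinite {U | F.IsUp U}).toFinset

@[simp]
theorem mem_upSets (F : RootedForest V) [Finite V] {U : Set V} : U ∈ F.upSets ↔ F.IsUp U := by
  simp [upSets]

theorem AdmissibleCut.isUp_lea {F : RootedForest V} (v : F.AdmissibleCut) : F.IsUp v.lea := by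
  rintro a b h ⟨c, hc, hbc⟩
  exact ⟨c, hc, Relation.ReflTransGen.head h hbc⟩

/-- The cut is recovered as the set of lowest vertices of `lea`: going from an element of one cut
down to one of the other and back to the first must return to the start by admissibility, so
antisymmetry makes them all equal. -/
theorem AdmissibleCut.lea_injective {F : RootedForest V} :
    Function.Injective (AdmissibleCut.lea (F := F)) := by
  have key : ∀ v w : F.AdmissibleCut, v.lea = w.lea → v.1 ⊆ w.1 := by
    intro v w h a ha
    obtain ⟨b, hb, hab⟩ : a ∈ w.lea := h ▸ ⟨a, ha, .refl⟩
    obtain ⟨c, hc, hbc⟩ : b ∈ v.lea := h ▸ ⟨b, hb, .refl⟩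
    have : a = c := by
      by_contra hne
      exact v.2 a ha c hc hne (Relation.ReflTransGen.trans hab hbc)
    subst this
    rwa [F.above_antisymm hab hbc]
  exact fun v w h => Subtype.ext (Set.Subset.antisymm (key v w h) (key w v h.symm))

/-- The cut consists of the vertices of `U` with no outgoing edge staying in `U`; a descending path
from any vertex of `U` reaches one of them. -/
theorem IsUp.exists_lea_eq [Finite V] {F : RootedForest V} {U : Set V} (hU : F.IsUp U) :
    ∃ v : F.AdmissibleCut, v.lea = U := by
  refine ⟨⟨{a | a ∈ U ∧ ∀ b, F.edge a b → b ∉ U}, ?_⟩, ?_⟩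
  · rintro a ⟨-, ha⟩ b ⟨hb, -⟩ hne hab
    rcases Relation.ReflTransGen.cases_head hab with rfl | ⟨c, hc, h⟩
    · exact hne rfl
    · exact ha c hc (hU.mem_of_above h hb)
  · refine Set.Subset.antisymm ?_ fun x hx => ?_
    · rintro x ⟨a, ⟨ha, -⟩, hxa⟩
      exact hU.mem_of_above hxa ha
    · induction x using F.wellFounded_edge.induction with
      | h x ih =>
        by_cases h : ∃ b, F.edge x b ∧ b ∈ U
        · obtain ⟨b, hxb, hb⟩ := h
          obtain ⟨a, ha, hba⟩ := ih b hxb hb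
          exact ⟨a, ha, Relation.ReflTransGen.head hxb hba⟩
        · push Not at h
          exact ⟨x, ⟨hx, h⟩, .refl⟩

/-- Admissible cuts correspond to up-closed sets of vertices. -/
theorem sum_admissibleCut [Finite V] {M : Type*} [AddCommMonoid M] (F : RootedForest V)
    (f : Set V → M) : ∑ v : F.AdmissibleCut, f v.lea = ∑ U ∈ F.upSets, f U := by
  refine Finset.sum_bij (fun v _ => v.lea) (fun v _ => by simpa using v.isUp_lea)
    (fun v _ w _ h => AdmissibleCut.lea_injective h) (fun U hU => ?_) fun _ _ => rfl
  obtain ⟨v, hv⟩ := IsUp.exists_lea_eq (F.mem_upSets.1 hU)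
  exact ⟨v, Finset.mem_univ _, hv⟩

end RootedForest

/-! ### Isomorphism classes of subforests -/

namespace ForestClass

variable {V W D : Type*}

theorem mk_induce_congr [Finite V] (F : DecForest V D) {S T : Set V} (h : S = T) :
    mk (F.induce S) = mk (F.induce T) := by
  subst h
  rfl

theorem mk_induce_induce [Finite V] (F : DecForest V D) (S : Set V) (T : Set S) :
    mk ((F.induce S).induce T) = mk (F.induce (Subtype.val '' T)) :=
  mk_eq_mk.2 ⟨Equiv.Set.image _ T Subtype.val_injective, fun _ _ => Iff.rfl, fun _ => rfl⟩

theorem mk_induce_univ [Finite V] (F : DecForest V D) : mk (F.induce Set.univ) = mk F :=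
  mk_eq_mk.2 ⟨Equiv.Set.univ V, fun _ _ => Iff.rfl, fun _ => rfl⟩

theorem mk_eq_one_iff [Finite V] (F : DecForest V D) : mk F = 1 ↔ IsEmpty V := by
  refine mk_eq_mk.trans ⟨fun ⟨f, _⟩ => f.isEmpty, fun h => ?_⟩
  exact ⟨Equiv.equivOfIsEmpty _ _, fun u => h.elim u, fun u => h.elim u⟩

theorem isTree_mk_iff [Finite V] (F : DecForest V D) : (mk F).IsTree ↔ F.IsTree := by
  constructor
  · rintro ⟨n, G, hG, h⟩
    exact (mk_eq_mk.1 h).isTree hG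
  · exact fun h => (TreeClass.mk F h).2

/-- A set of vertices that no edge enters or leaves splits the forest. -/
theorem mk_induce_mul_mk_induce_compl [Finite V] (F : DecForest V D) (S : Set V)
    (h : ∀ a b, F.edge a b → (a ∈ S ↔ b ∈ S)) :
    mk (F.induce S) * mk (F.induce Sᶜ) = mk F := by
  classical
  rw [mk_mul_mk]
  refine mk_eq_mk.2 ⟨Equiv.Set.sumCompl S, ?_, ?_⟩
  · rintro (u | u) (v | v)
    · exact ⟨fun k => .inl k, fun k => by cases k; assumption⟩
    · exact ⟨fun k => absurd ((h _ _ k).1 u.2) v.2, fun k => by cases k⟩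
    · exact ⟨fun k => absurd ((h _ _ k).2 v.2) u.2, fun k => by cases k⟩
    · exact ⟨fun k => .inr k, fun k => by cases k; assumption⟩
  · rintro (u | u) <;> rfl

/-- A forest is empty, a tree, or a product of two nonempty forests. -/
theorem eq_one_or_isTree_or_mul (c : ForestClass D) :
    c = 1 ∨ c.IsTree ∨ ∃ a b : ForestClass D, a ≠ 1 ∧ b ≠ 1 ∧ a * b = c := by
  obtain ⟨n, F, rfl⟩ := exists_rep c
  rcases isEmpty_or_nonempty (Fin n) with h | ⟨⟨x⟩⟩
  · exact .inl ((mk_eq_one_iff F).2 h)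
  -- Here `r` is a root. Then `F.up r` is its whole component, and unless it exhausts the forest it
  -- splits off as a proper factor.
  obtain ⟨r, -, hr⟩ := F.exists_exit (S := Set.univ) ⟨x, trivial⟩
  by_cases hF : ∀ x, F.Above x r
  · exact .inr (.inl ((isTree_mk_iff F).2 (RootedForest.isTree_of_above hF)))
  push Not at hF
  obtain ⟨y, hy⟩ := hF
  refine .inr (.inr ⟨_, _, ?_, ?_, mk_induce_mul_mk_induce_compl F (F.up r) fun a b h => ?_⟩)
  · rw [Ne, mk_eq_one_iff]
    exact fun h => h.elim ⟨r, F.mem_up_self r⟩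
  · rw [Ne, mk_eq_one_iff]
    exact fun h => h.elim ⟨y, hy⟩
  · refine ⟨fun k => ?_, F.isUp_up r a b h⟩
    rcases Relation.ReflTransGen.cases_head k with rfl | ⟨c, hc, k⟩
    · exact absurd trivial (hr b h)
    · exact F.edge_unique hc h ▸ k

end ForestClass

end

/-! ### Layerings and the recursive formula for the image of a forest -/

section

variable {K D : Type*} [Field K]

open Classical in
/-- The linear map `φ` extended by zero to the forests that are not trees. -/
noncomputable def treeValue (φ : (TreeClass D →₀ K) →ₗ[K] (D →₀ K)) (c : ForestClass D) :
    D →₀ K :=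
  if h : c.IsTree then φ (Finsupp.single ⟨c, h⟩ 1) else 0

theorem treeValue_val (φ : (TreeClass D →₀ K) →ₗ[K] (D →₀ K)) (t : TreeClass D) :
    treeValue φ t.1 = φ (Finsupp.single t 1) := dif_pos t.2

namespace RootedForest

variable {V W : Type*}

/-- Ordered partitions of the vertices into `k` trees, numbered compatibly with the edges: these
encode the contractions with a linear order. -/
def Layering (F : RootedForest V) (k : ℕ) : Type _ :=
  {p : V → Fin k // (∀ a b, F.edge a b → p b ≤ p a) ∧ ∀ i, F.IsRooted (p ⁻¹' {i})}

noncomputable instance (F : RootedForest V) (k : ℕ) [Finite V] : Fintype (F.Layering k) :=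
  @Fintype.ofFinite _ (inferInstanceAs (Finite {_p : V → Fin k // _}))

theorem Layering.surjective {F : RootedForest V} {k : ℕ} (p : F.Layering k) :
    Function.Surjective p.1 := fun i => by
  obtain ⟨r, hr, -⟩ := p.2.2 i
  exact ⟨r, hr⟩

theorem Layering.le_card [Finite V] {F : RootedForest V} {k : ℕ} (p : F.Layering k) :
    k ≤ Nat.card V := by
  simpa using Nat.card_le_card_of_surjective _ p.surjective

open Classical in
/-- Add the vertices above `v` as the last part of a layering of the other vertices. -/
noncomputable def Layering.snoc {F : RootedForest V} {k : ℕ} (v : V)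
    (p : (F.induce (F.up v)ᶜ).Layering k) : F.Layering (k + 1) where
  val x := if h : x ∈ F.up v then Fin.last k else (p.1 ⟨x, h⟩).castSucc
  property := by
    constructor
    · intro a b h
      by_cases ha : a ∈ F.up v
      · simpa [ha] using Fin.le_last _
      · have hb : b ∉ F.up v := fun hb => ha (F.isUp_up v a b h hb)
        simpa [ha, hb] using p.2.1 ⟨a, ha⟩ ⟨b, hb⟩ h
    · intro i
      induction i using Fin.lastCases with
      | last =>
        convert F.isRooted_up v
        ext x
        by_cases hx : x ∈ F.up v <;> simp [hx, Fin.castSucc_ne_last]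
      | cast i =>
        convert (F.isRooted_induce_iff _ _).1 (p.2.2 i)
        ext x
        by_cases hx : x ∈ F.up v <;> simp [hx, (Fin.castSucc_ne_last i).symm]

theorem Layering.snoc_apply_of_mem {F : RootedForest V} {k : ℕ} {v : V}
    (p : (F.induce (F.up v)ᶜ).Layering k) {x : V} (hx : x ∈ F.up v) :
    (snoc v p).1 x = Fin.last k := dif_pos hx

theorem Layering.snoc_apply_of_notMem {F : RootedForest V} {k : ℕ} {v : V}
    (p : (F.induce (F.up v)ᶜ).Layering k) {x : V} (hx : x ∉ F.up v) :
    (snoc v p).1 x = (p.1 ⟨x, hx⟩).castSucc := dif_neg hx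

theorem Layering.snoc_preimage_last {F : RootedForest V} {k : ℕ} {v : V}
    (p : (F.induce (F.up v)ᶜ).Layering k) : (snoc v p).1 ⁻¹' {Fin.last k} = F.up v := by
  ext x
  by_cases hx : x ∈ F.up v
  · simp [snoc_apply_of_mem p hx, hx]
  · simp [snoc_apply_of_notMem p hx, hx, Fin.castSucc_ne_last]

theorem Layering.snoc_preimage_castSucc {F : RootedForest V} {k : ℕ} {v : V}
    (p : (F.induce (F.up v)ᶜ).Layering k) (i : Fin k) :
    (snoc v p).1 ⁻¹' {i.castSucc} = Subtype.val '' (p.1 ⁻¹' {i}) := by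
  ext x
  by_cases hx : x ∈ F.up v
  · simp [snoc_apply_of_mem p hx, hx, (Fin.castSucc_ne_last i).symm]
  · simp [snoc_apply_of_notMem p hx, hx]

/-- Monotonicity makes the fibre of the largest number up-closed. Being rooted too, it is the set
above one vertex, which it determines; the remaining fibres are rooted sets in the complement. -/
theorem Layering.snoc_bijective (F : RootedForest V) [Finite V] (k : ℕ) :
    Function.Bijective fun x : Σ v, (F.induce (F.up v)ᶜ).Layering k => snoc x.1 x.2 := by
  constructor
  · rintro ⟨v, p⟩ ⟨w, q⟩ h
    dsimp only at h
    obtain rfl : v = w := F.up_injective <| by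
      rw [← snoc_preimage_last p, ← snoc_preimage_last q, h]
    congr 1
    refine Subtype.ext (funext fun x => ?_)
    have := congrFun (congrArg Subtype.val h) x.1
    rwa [snoc_apply_of_notMem p x.2, snoc_apply_of_notMem q x.2, Fin.castSucc_inj] at this
  · intro p
    obtain ⟨v, hv⟩ := (p.2.2 (Fin.last k)).exists_eq_up fun a b h hb => by
      have := p.2.1 a b h
      rw [Set.mem_preimage, Set.mem_singleton_iff] at hb ⊢
      exact Fin.last_le_iff.1 (hb ▸ this)
    have hne : ∀ x : ↥(F.up v)ᶜ, p.1 x ≠ Fin.last k := fun x h => x.2 (hv.subset h)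
    have hpre : ∀ i : Fin k, Subtype.val '' ((fun x : ↥(F.up v)ᶜ => (p.1 x).castPred (hne x)) ⁻¹'
        {i}) = p.1 ⁻¹' {i.castSucc} := by
      intro i
      ext x
      constructor
      · rintro ⟨x, hx, rfl⟩
        simp only [Set.mem_preimage, Set.mem_singleton_iff] at hx ⊢
        simp [← hx]
      · intro hx
        simp only [Set.mem_preimage, Set.mem_singleton_iff] at hx
        refine ⟨⟨x, fun h => ?_⟩, ?_, rfl⟩
        · rw [← hv, Set.mem_preimage, Set.mem_singleton_iff, hx] at h
          exact Fin.castSucc_ne_last i h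
        · simp [hx]
    refine ⟨⟨v, fun x => (p.1 x).castPred (hne x), fun a b h => ?_, fun i => ?_⟩, ?_⟩
    · simpa using p.2.1 _ _ h
    · rw [isRooted_induce_iff, hpre]
      exact p.2.2 _
    · refine Subtype.ext (funext fun x => ?_)
      by_cases hx : x ∈ F.up v
      · rw [snoc_apply_of_mem _ hx]
        rw [← hv] at hx
        exact hx.symm
      · rw [snoc_apply_of_notMem _ hx]
        simp

end RootedForest

variable {V W : Type*} (φ : (TreeClass D →₀ K) →ₗ[K] (D →₀ K))

/-- The word of a layering: the letters are the values of `φ` at the parts, the last part first. -/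
noncomputable def layerWord [Finite V] (F : DecForest V D) {k : ℕ} (p : F.Layering k) : Sh K D :=
  Sh.tensorWord <| List.ofFn fun i : Fin k =>
    treeValue φ (.mk (F.induce (p.1 ⁻¹' {i.rev})))

/-- The sum of the words of the layerings with `k` parts. -/
noncomputable def layerSum [Finite V] (F : DecForest V D) (k : ℕ) : Sh K D :=
  ∑ p : F.Layering k, layerWord φ F p

theorem layerSum_eq_of_isom [Finite V] [Finite W] {F : DecForest V D} {G : DecForest W D}
    (h : F.Isom G) (k : ℕ) : layerSum φ F k = layerSum φ G k := by
  obtain ⟨f, h, h'⟩ := h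
  have key : ∀ p : W → Fin k, ((∀ a b, F.edge a b → p (f b) ≤ p (f a)) ∧
      ∀ i, F.IsRooted ((p ∘ f) ⁻¹' {i})) ↔
      (∀ a b, G.edge a b → p b ≤ p a) ∧ ∀ i, G.IsRooted (p ⁻¹' {i}) := fun p => by
    simp only [Set.preimage_comp, RootedForest.isRooted_iff_of_equiv f h, ← h]
    refine and_congr_left' ?_
    rw [f.forall_congr_left]
    simp [f.forall_congr_left]
  let E : F.Layering k ≃ G.Layering k :=
    (f.arrowCongr (Equiv.refl _)).subtypeEquiv fun p => by
      rw [← key]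
      simp [Function.comp_def]
  refine Fintype.sum_equiv E _ _ fun p => ?_
  refine congrArg Sh.tensorWord (congrArg List.ofFn (funext fun i => congrArg _ ?_))
  refine ForestClass.mk_eq_mk.2 (.induce f h h' fun v => ?_)
  change p.1 (f.symm (f v)) = _ ↔ p.1 v = _
  rw [f.symm_apply_apply]

theorem layerSum_zero [Finite V] (F : DecForest V D) [Decidable (IsEmpty V)] :
    layerSum φ F 0 = if IsEmpty V then 1 else 0 := by
  split_ifs with h
  · have : Unique (F.Layering 0) :=
      { default := ⟨fun v => h.elim v, fun a => h.elim a, fun i => i.elim0⟩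
        uniq := fun p => Subtype.ext (funext fun v => h.elim v) }
    simp [layerSum, layerWord, Sh.tensorWord, Sh.one_def]
  · have : IsEmpty (F.Layering 0) := ⟨fun p => h ⟨fun v => (p.1 v).elim0⟩⟩
    simp [layerSum]

theorem layerSum_eq_zero [Finite V] (F : DecForest V D) {k : ℕ} (h : Nat.card V < k) :
    layerSum φ F k = 0 := by
  have : IsEmpty (F.Layering k) := ⟨fun p => h.not_ge p.le_card⟩
  simp [layerSum]

/-- Words are read from the last part downwards, so a part added at the end of the numbering becomes
the first letter. -/
theorem layerWord_snoc [Finite V] (F : DecForest V D) {k : ℕ} (v : V)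
    (p : (F.induce (F.up v)ᶜ).Layering k) : layerWord φ F (.snoc v p) =
      Sh.lcons (treeValue φ (.mk (F.induce (F.up v)))) (layerWord φ (F.induce (F.up v)ᶜ) p) := by
  rw [layerWord, List.ofFn_succ, Sh.tensorWord_cons]
  simp only [layerWord, ForestClass.mk_induce_induce]
  congr 3
  · exact ForestClass.mk_induce_congr F (by rw [Fin.rev_zero]; exact RootedForest.Layering.snoc_preimage_last p)
  · funext i
    refine congrArg _ (ForestClass.mk_induce_congr F ?_)
    rw [Fin.rev_succ]
    exact RootedForest.Layering.snoc_preimage_castSucc p i.rev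

theorem layerSum_succ [Fintype V] (F : DecForest V D) (k : ℕ) : layerSum φ F (k + 1) =
    ∑ v, Sh.lcons (treeValue φ (.mk (F.induce (F.up v)))) (layerSum φ (F.induce (F.up v)ᶜ) k) := by
  rw [layerSum, ← (RootedForest.Layering.snoc_bijective F.toRootedForest k).sum_comp,
    Fintype.sum_sigma]
  refine Finset.sum_congr rfl fun v _ => ?_
  rw [layerSum, map_sum]
  exact Finset.sum_congr rfl fun p _ => layerWord_snoc φ F v p

/-- The image of a forest under the morphism that extends `φ`. -/
noncomputable def forestImage : ForestClass D → Sh K D :=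
  -- Parts are nonempty, so there are never more parts than vertices and this range covers all
  -- layerings.
  Quotient.lift (fun F => ∑ k ∈ Finset.range (F.1 + 1), layerSum φ F.2 k) fun F G h => by
    have : F.1 = G.1 := by
      obtain ⟨f, _⟩ := h
      simpa using Nat.card_congr f
    exact Finset.sum_congr (by rw [this]) fun k _ => layerSum_eq_of_isom φ h k

theorem forestImage_mk_of_lt [Finite V] (F : DecForest V D) {n : ℕ} (h : Nat.card V < n) :
    forestImage φ (.mk F) = ∑ k ∈ Finset.range n, layerSum φ F k := by
  have : forestImage φ (.mk F) = ∑ k ∈ Finset.range (Nat.card V + 1), layerSum φ F k :=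
    Finset.sum_congr rfl fun k _ => layerSum_eq_of_isom φ (F.isom_comap_equiv _) k
  rw [this]
  refine Finset.sum_subset (Finset.range_subset_range.2 h) fun k _ hk => ?_
  exact layerSum_eq_zero φ F (by simpa using hk)

theorem card_compl_up_lt [Finite V] (F : RootedForest V) (v : V) :
    Nat.card ↥(F.up v)ᶜ < Nat.card V :=
  Finite.card_subtype_lt (x := v) (by simpa using F.mem_up_self v)

/-- The recursive description, by the tree of the first letter. -/
theorem forestImage_mk [Fintype V] (F : DecForest V D) [Decidable (IsEmpty V)] :
    forestImage φ (.mk F) = (if IsEmpty V then 1 else 0) +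
      ∑ v, Sh.lcons (treeValue φ (.mk (F.induce (F.up v))))
        (forestImage φ (.mk (F.induce (F.up v)ᶜ))) := by
  rw [forestImage_mk_of_lt φ F (Nat.lt_succ_self _), Finset.sum_range_succ', layerSum_zero,
    add_comm]
  simp only [layerSum_succ]
  rw [Finset.sum_comm]
  congr 1
  refine Finset.sum_congr rfl fun v _ => ?_
  -- Splitting off the first letter leaves the range `Nat.card V`, one shorter than before; it still
  -- suffices because the complement has fewer vertices.
  rw [forestImage_mk_of_lt φ _ (card_compl_up_lt F.toRootedForest v), map_sum]

end

/-! ### Disjoint unions and multiplicativity -/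

section

variable {K D : Type*} [Field K] {V W : Type*}

namespace RootedForest

theorem above_sum_inl (F : RootedForest V) (G : RootedForest W) (x : V ⊕ W) (v : V) :
    (F.sum G).Above x (.inl v) ↔ ∃ u, x = .inl u ∧ F.Above u v := by
  constructor
  · intro h
    induction h using Relation.ReflTransGen.head_induction_on with
    | refl => exact ⟨v, rfl, .refl⟩
    | head h _ ih =>
      obtain ⟨u, rfl, hu⟩ := ih
      cases h with
      | inl h => exact ⟨_, rfl, hu.head h⟩
  · rintro ⟨u, rfl, hu⟩
    exact Relation.ReflTransGen.lift Sum.inl (fun _ _ h => .inl h) _ _ hu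

theorem above_sum_inr (F : RootedForest V) (G : RootedForest W) (x : V ⊕ W) (w : W) :
    (F.sum G).Above x (.inr w) ↔ ∃ u, x = .inr u ∧ G.Above u w := by
  constructor
  · intro h
    induction h using Relation.ReflTransGen.head_induction_on with
    | refl => exact ⟨w, rfl, .refl⟩
    | head h _ ih =>
      obtain ⟨u, rfl, hu⟩ := ih
      cases h with
      | inr h => exact ⟨_, rfl, hu.head h⟩
  · rintro ⟨u, rfl, hu⟩
    exact Relation.ReflTransGen.lift Sum.inr (fun _ _ h => .inr h) _ _ hu

theorem up_sum_inl (F : RootedForest V) (G : RootedForest W) (v : V) :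
    (F.sum G).up (.inl v) = Sum.inl '' F.up v := by
  ext x
  simp [up, above_sum_inl, eq_comm, and_comm]

theorem up_sum_inr (F : RootedForest V) (G : RootedForest W) (w : W) :
    (F.sum G).up (.inr w) = Sum.inr '' G.up w := by
  ext x
  simp [up, above_sum_inr, eq_comm, and_comm]

end RootedForest

namespace ForestClass

variable [Finite V] [Finite W]

theorem mk_induce_empty (F : DecForest V D) : mk (F.induce ∅) = 1 :=
  (mk_eq_one_iff _).2 inferInstance

theorem mk_sum_induce (F : DecForest V D) (G : DecForest W D) (S : Set (V ⊕ W)) :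
    mk ((F.sum G).induce S) = mk (F.induce (Sum.inl ⁻¹' S)) * mk (G.induce (Sum.inr ⁻¹' S)) := by
  rw [mk_mul_mk]
  refine (mk_eq_mk.2 ⟨Equiv.subtypeSum.symm, ?_, ?_⟩).symm
  · rintro (⟨u, hu⟩ | ⟨u, hu⟩) (⟨v, hv⟩ | ⟨v, hv⟩)
    · exact ⟨fun | .inl h => .inl h, fun | .inl h => .inl h⟩
    · exact ⟨(nomatch ·), (nomatch ·)⟩
    · exact ⟨(nomatch ·), (nomatch ·)⟩
    · exact ⟨fun | .inr h => .inr h, fun | .inr h => .inr h⟩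
  · rintro (u | u) <;> rfl

theorem mk_sum_induce_up_inl (F : DecForest V D) (G : DecForest W D) (v : V) :
    mk ((F.sum G).induce ((F.sum G).up (.inl v))) = mk (F.induce (F.up v)) := by
  have h : (F.sum G).up (.inl v) = Sum.inl '' F.up v := RootedForest.up_sum_inl _ _ v
  rw [mk_induce_congr _ h, mk_sum_induce,
    mk_induce_congr F (Set.preimage_image_eq _ Sum.inl_injective),
    mk_induce_congr G (Set.preimage_inr_image_inl _), mk_induce_empty, mul_one]

theorem mk_sum_induce_up_inr (F : DecForest V D) (G : DecForest W D) (w : W) :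
    mk ((F.sum G).induce ((F.sum G).up (.inr w))) = mk (G.induce (G.up w)) := by
  have h : (F.sum G).up (.inr w) = Sum.inr '' G.up w := RootedForest.up_sum_inr _ _ w
  rw [mk_induce_congr _ h, mk_sum_induce,
    mk_induce_congr G (Set.preimage_image_eq _ Sum.inr_injective),
    mk_induce_congr F (Set.preimage_inl_image_inr _), mk_induce_empty, one_mul]

theorem mk_sum_induce_compl_up_inl (F : DecForest V D) (G : DecForest W D) (v : V) :
    mk ((F.sum G).induce ((F.sum G).up (.inl v))ᶜ) = mk (F.induce (F.up v)ᶜ) * mk G := by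
  have h : (F.sum G).up (.inl v) = Sum.inl '' F.up v := RootedForest.up_sum_inl _ _ v
  rw [mk_induce_congr _ (congrArg compl h), mk_sum_induce,
    mk_induce_congr F ((Set.preimage_compl).trans (congrArg compl (Set.preimage_image_eq _ Sum.inl_injective))),
    mk_induce_congr G ((Set.preimage_compl).trans (congrArg compl (Set.preimage_inr_image_inl _))),
    mk_induce_congr G Set.compl_empty, mk_induce_univ]

theorem mk_sum_induce_compl_up_inr (F : DecForest V D) (G : DecForest W D) (w : W) :
    mk ((F.sum G).induce ((F.sum G).up (.inr w))ᶜ) = mk F * mk (G.induce (G.up w)ᶜ) := by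
  have h : (F.sum G).up (.inr w) = Sum.inr '' G.up w := RootedForest.up_sum_inr _ _ w
  rw [mk_induce_congr _ (congrArg compl h), mk_sum_induce,
    mk_induce_congr G ((Set.preimage_compl).trans (congrArg compl (Set.preimage_image_eq _ Sum.inr_injective))),
    mk_induce_congr F ((Set.preimage_compl).trans (congrArg compl (Set.preimage_inl_image_inr _))),
    mk_induce_congr F Set.compl_empty, mk_induce_univ]

end ForestClass

theorem Sh.sum_lcons_mul_sum_lcons [Fintype V] [Fintype W] (a : V → D →₀ K) (x : V → Sh K D)
    (b : W → D →₀ K) (y : W → Sh K D) :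
    (∑ v, lcons (a v) (x v)) * ∑ w, lcons (b w) (y w) =
      ∑ v, lcons (a v) (x v * ∑ w, lcons (b w) (y w)) +
        ∑ w, lcons (b w) ((∑ v, lcons (a v) (x v)) * y w) := by
  simp only [Finset.mul_sum, Finset.sum_mul, map_sum, lcons_mul_lcons, Finset.sum_add_distrib]
  rw [Finset.sum_comm, add_right_inj, Finset.sum_comm]

variable (φ : (TreeClass D →₀ K) →ₗ[K] (D →₀ K))

theorem forestImage_one : forestImage φ (1 : ForestClass D) = 1 := by
  classical
  have h : ForestClass.mk (ForestClass.emptyForest D) = 1 := rfl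
  rw [← h, forestImage_mk]
  simp

theorem forestImage_mk_of_nonempty [Fintype V] [Nonempty V] (F : DecForest V D) :
    forestImage φ (.mk F) = ∑ v, Sh.lcons (treeValue φ (.mk (F.induce (F.up v))))
        (forestImage φ (.mk (F.induce (F.up v)ᶜ))) := by
  classical
  rw [forestImage_mk, if_neg (not_isEmpty_of_nonempty V), zero_add]

/-- Induction on the total number of vertices. A vertex of the disjoint union lies in `F` or in `G`,
just as the first letter of a shuffle comes from one of the two factors; removing what lies above it
leaves the other forest intact. Empty forests are treated apart, since the recursion then has the
extra term `1`. -/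
theorem forestImage_mk_mul_mk [Finite V] [Finite W] (F : DecForest V D) (G : DecForest W D) :
    forestImage φ (.mk F * .mk G) = forestImage φ (.mk F) * forestImage φ (.mk G) := by
  have := Fintype.ofFinite V
  have := Fintype.ofFinite W
  induction h : Nat.card V + Nat.card W using Nat.strong_induction_on generalizing V W with
  | h n ih =>
    rcases isEmpty_or_nonempty V with hV | hV
    · rw [(ForestClass.mk_eq_one_iff F).2 hV, forestImage_one, one_mul, one_mul]
    rcases isEmpty_or_nonempty W with hW | hW
    · rw [(ForestClass.mk_eq_one_iff G).2 hW, forestImage_one, mul_one, mul_one]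
    rw [ForestClass.mk_mul_mk, forestImage_mk_of_nonempty φ (F.sum G), Fintype.sum_sum_type,
      forestImage_mk_of_nonempty φ F, forestImage_mk_of_nonempty φ G,
      Sh.sum_lcons_mul_sum_lcons, ← forestImage_mk_of_nonempty φ F,
      ← forestImage_mk_of_nonempty φ G]
    congr 1
    · refine Finset.sum_congr rfl fun v _ => ?_
      have hv := card_compl_up_lt F.toRootedForest v
      rw [ForestClass.mk_sum_induce_up_inl, ForestClass.mk_sum_induce_compl_up_inl,
        ih _ (by omega) _ _ (Fintype.ofFinite _) (Fintype.ofFinite _) rfl]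
    · refine Finset.sum_congr rfl fun w _ => ?_
      have hw := card_compl_up_lt G.toRootedForest w
      rw [ForestClass.mk_sum_induce_up_inr, ForestClass.mk_sum_induce_compl_up_inr,
        ih _ (by omega) _ _ (Fintype.ofFinite _) (Fintype.ofFinite _) rfl]

theorem forestImage_mul (a b : ForestClass D) :
    forestImage φ (a * b) = forestImage φ a * forestImage φ b := by
  obtain ⟨n, F, rfl⟩ := a.exists_rep
  obtain ⟨m, G, rfl⟩ := b.exists_rep
  exact forestImage_mk_mul_mk φ F G

open Classical in
theorem counit_forestImage (c : ForestClass D) :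
    Coalgebra.counit (R := K) (forestImage φ c) = if c = 1 then 1 else 0 := by
  obtain ⟨n, F, rfl⟩ := c.exists_rep
  rw [forestImage_mk, map_add, map_sum]
  simp only [Sh.counit_lcons, Finset.sum_const_zero, add_zero, ForestClass.mk_eq_one_iff]
  split_ifs <;> simp

/-- In the recursion, π keeps only terms whose remaining forest is empty, and for a tree this
happens only when the chosen vertex is the root. -/
theorem proj_forestImage_of_isTree {c : ForestClass D} (hc : c.IsTree) :
    Sh.proj K D (forestImage φ c) = treeValue φ c := by
  classical
  obtain ⟨n, F, hF, rfl⟩ := hc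
  obtain ⟨r, hr⟩ := hF.exists_above
  have hr' : F.up r = Set.univ := Set.eq_univ_of_forall hr
  have : Nonempty (Fin n) := ⟨r⟩
  rw [forestImage_mk_of_nonempty, map_sum, Finset.sum_eq_single r]
  · rw [Sh.proj_lcons, counit_forestImage, ForestClass.mk_induce_congr F hr',
      ForestClass.mk_induce_univ,
      ForestClass.mk_induce_congr F ((congrArg compl hr').trans Set.compl_univ),
      ForestClass.mk_induce_empty, if_pos rfl, one_smul]
  · intro v _ hv
    rw [Sh.proj_lcons, counit_forestImage, if_neg, zero_smul]
    rw [ForestClass.mk_eq_one_iff, Set.isEmpty_coe_sort, Set.compl_empty_iff, ← hr']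
    exact fun h => hv (F.up_injective h)
  · simp

open Classical in
-- Compatibility with the coproduct
/-- The recursive description in an up-closed set of vertices. -/
theorem forestImage_mk_induce [Fintype V] (F : DecForest V D) {U : Set V} (hU : F.IsUp U) :
    forestImage φ (.mk (F.induce U)) = (if U = ∅ then 1 else 0) +
      ∑ v, if v ∈ U then Sh.lcons (treeValue φ (.mk (F.induce (F.up v))))
        (forestImage φ (.mk (F.induce (U \ F.up v)))) else 0 := by
  rw [forestImage_mk, ← Finset.sum_filter]
  congr 1
  · simp only [Set.isEmpty_coe_sort]
  · rw [Finset.sum_subtype (p := (· ∈ U)) _ (by simp)]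
    refine Finset.sum_congr rfl fun v _ => ?_
    have h : Subtype.val '' (F.induce U).up v = F.up v := hU.induce_up v
    have h' : Subtype.val '' ((F.induce U).up v)ᶜ = U \ F.up v := by
      rw [Set.image_compl_eq_range_sdiff_image Subtype.val_injective, Subtype.range_val, h]
    rw [ForestClass.mk_induce_induce, ForestClass.mk_induce_induce,
      ForestClass.mk_induce_congr F h, ForestClass.mk_induce_congr F h']

/-- The up-closed sets that contain `v` correspond to those of the complement of the set of
vertices above `v`. -/
theorem RootedForest.sum_upSets_compl_up [Finite V] {M : Type*} [AddCommMonoid M]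
    (F : RootedForest V) (v : V) (f : Set V → M) [DecidablePred fun U : Set V => v ∈ U] :
    ∑ U ∈ (F.induce (F.up v)ᶜ).upSets, f (Subtype.val '' U ∪ F.up v) =
      ∑ U ∈ F.upSets with v ∈ U, f U := by
  refine Finset.sum_bij' (fun U _ => Subtype.val '' U ∪ F.up v) (fun U _ => Subtype.val ⁻¹' U)
    ?_ ?_ ?_ ?_ fun _ _ => rfl
  · intro U hU
    rw [mem_upSets] at hU
    rw [Finset.mem_filter, mem_upSets]
    refine ⟨?_, .inr (F.mem_up_self v)⟩
    intro a b h hb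
    by_cases ha : a ∈ F.up v
    · exact .inr ha
    have hb' : b ∉ F.up v := fun hb => ha (F.isUp_up v a b h hb)
    rcases hb with ⟨b, hb, rfl⟩ | hb
    · exact .inl ⟨⟨a, ha⟩, hU _ _ h hb, rfl⟩
    · exact absurd hb hb'
  · intro U hU
    rw [Finset.mem_filter, mem_upSets] at hU
    rw [mem_upSets]
    exact fun a b h hb => hU.1 _ _ h hb
  · intro U _
    ext x
    have := x.2
    simp_all
  · intro U hU
    rw [Finset.mem_filter, mem_upSets] at hU
    rw [Subtype.image_preimage_coe, Set.inter_comm, Set.union_comm, ← Set.sdiff_eq,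
      Set.union_sdiff_self, Set.union_eq_right]
    exact hU.1.up_subset hU.2

/-- Induction on the number of vertices, comparing first letters in the left tensor factor. The
terms `1 ⊗ Φ(F)` agree with `U = ∅`. A first letter from `v` amounts, on one side, to an up-closed
set of the complement of `F.up v`, and on the other to an up-closed `U` containing `v`; these
correspond by adding or removing `F.up v`. -/
theorem comul_forestImage_mk [Finite V] (F : DecForest V D) :
    CoalgebraStruct.comul (R := K) (forestImage φ (.mk F)) =
      ∑ U ∈ F.upSets,
        forestImage φ (.mk (F.induce U)) ⊗ₜ[K] forestImage φ (.mk (F.induce Uᶜ)) := by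
  classical
  have := Fintype.ofFinite V
  induction h : Nat.card V using Nat.strong_induction_on generalizing V with
  | h n ih =>
    have hleft : CoalgebraStruct.comul (R := K) (forestImage φ (.mk F)) =
        1 ⊗ₜ[K] forestImage φ (.mk F) +
        ∑ v, (Sh.lcons (treeValue φ (.mk (F.induce (F.up v))))).rTensor (Sh K D)
          (CoalgebraStruct.comul (R := K) (forestImage φ (.mk (F.induce (F.up v)ᶜ)))) := by
      rw [forestImage_mk, map_add, map_sum]
      simp only [Sh.comul_lcons, Finset.sum_add_distrib, TensorProduct.tmul_add,
        TensorProduct.tmul_sum]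
      rw [← add_assoc]
      congr 2
      split_ifs <;> simp [Sh.comul_one]
    have hright : ∑ U ∈ F.upSets,
        forestImage φ (.mk (F.induce U)) ⊗ₜ[K] forestImage φ (.mk (F.induce Uᶜ)) =
        1 ⊗ₜ[K] forestImage φ (.mk F) + ∑ v, ∑ U ∈ F.upSets with v ∈ U,
          Sh.lcons (treeValue φ (.mk (F.induce (F.up v))))
            (forestImage φ (.mk (F.induce (U \ F.up v)))) ⊗ₜ[K]
              forestImage φ (.mk (F.induce Uᶜ)) := by
      rw [Finset.sum_congr rfl fun U hU => by
        rw [forestImage_mk_induce φ F (F.mem_upSets.1 hU), TensorProduct.add_tmul,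
          TensorProduct.sum_tmul]]
      rw [Finset.sum_add_distrib, Finset.sum_comm]
      congr 1
      · rw [Finset.sum_eq_single ∅]
        · rw [if_pos rfl, ForestClass.mk_induce_congr F Set.compl_empty,
            ForestClass.mk_induce_univ]
        · intro U _ hU
          rw [if_neg hU, TensorProduct.zero_tmul]
        · intro h
          exact absurd (F.mem_upSets.2 fun _ _ _ h => h.elim) h
      · refine Finset.sum_congr rfl fun v _ => ?_
        rw [Finset.sum_filter]
        refine Finset.sum_congr rfl fun U _ => ?_
        split_ifs <;> simp
    rw [hleft, hright]
    congr 1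
    refine Finset.sum_congr rfl fun v _ => ?_
    -- The induction hypothesis expands the coproduct for the complement of `F.up v`; the right-hand
    -- sum is then reindexed by the up-closed sets of that complement.
    rw [ih _ (h ▸ card_compl_up_lt F.toRootedForest v) _ (Fintype.ofFinite _) rfl, map_sum,
      ← RootedForest.sum_upSets_compl_up]
    refine Finset.sum_congr rfl fun U _ => ?_
    have h1 : (Subtype.val '' U ∪ F.up v) \ F.up v = Subtype.val '' U := by
      rw [Set.union_sdiff_right, sdiff_eq_left, Set.disjoint_left]
      rintro _ ⟨x, _, rfl⟩
      exact x.2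
    have h2 : Subtype.val '' Uᶜ = (Subtype.val '' U ∪ F.up v)ᶜ := by
      rw [Set.image_compl_eq_range_sdiff_image Subtype.val_injective, Subtype.range_val,
        Set.compl_union, Set.inter_comm, Set.sdiff_eq]
    rw [LinearMap.rTensor_tmul, ForestClass.mk_induce_induce, ForestClass.mk_induce_induce,
      ForestClass.mk_induce_congr F h1, ForestClass.mk_induce_congr F h2]

/-! ### The Hopf algebra morphism and its uniqueness -/

theorem HCK.hom_ext {M : Type*} [AddCommGroup M] [Module K M] {f g : HCK K D →ₗ[K] M}
    (h : ∀ c, f (HCK.of K c) = g (HCK.of K c)) : f = g :=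
  MonoidAlgebra.lhom_ext' fun c => LinearMap.ext_ring (h c)

theorem HCK.of_mul_of (a b : ForestClass D) : HCK.of K a * HCK.of K b = HCK.of K (a * b) :=
  (MonoidAlgebra.single_mul_single _ _ _ _).trans (by rw [one_mul]; rfl)

theorem HCK.one_def : (1 : HCK K D) = HCK.of K 1 := rfl

theorem HCK.comul_of_mk [Finite V] (F : DecForest V D) :
    CoalgebraStruct.comul (R := K) (HCK.of K (.mk F)) =
      ∑ U ∈ F.upSets, HCK.of K (.mk (F.induce U)) ⊗ₜ[K] HCK.of K (.mk (F.induce Uᶜ)) := by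
  rw [← F.toRootedForest.sum_admissibleCut fun U =>
    HCK.of K (.mk (F.induce U)) ⊗ₜ[K] HCK.of K (.mk (F.induce Uᶜ))]
  exact (HCK.linearLift_of K _ _).trans (cutSum_eq_of_isom K (F.isom_comap_equiv _))

open Classical in
theorem HCK.counit_of (c : ForestClass D) :
    Coalgebra.counit (R := K) (HCK.of K c) = if c = 1 then 1 else 0 :=
  HCK.linearLift_of K _ _

/-- The Hopf algebra morphism that extends `φ`. -/
noncomputable def extension : HCK K D →ₐc[K] Sh K D where
  toCoalgHom :=
    { HCK.linearLift K D (forestImage φ) with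
      counit_comp := by
        classical
        refine HCK.hom_ext fun c => ?_
        change Coalgebra.counit (R := K) (HCK.linearLift K D (forestImage φ) (HCK.of K c)) = _
        rw [HCK.linearLift_of, counit_forestImage, HCK.counit_of]
      map_comp_comul := by
        refine HCK.hom_ext fun c => ?_
        obtain ⟨n, F, rfl⟩ := c.exists_rep
        change TensorProduct.map (HCK.linearLift K D (forestImage φ))
          (HCK.linearLift K D (forestImage φ)) (CoalgebraStruct.comul (R := K) _) =
          CoalgebraStruct.comul (R := K) (HCK.linearLift K D (forestImage φ) _)
        rw [HCK.linearLift_of, comul_forestImage_mk, HCK.comul_of_mk, map_sum]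
        simp only [TensorProduct.map_tmul, HCK.linearLift_of] }
  map_one' := (HCK.linearLift_of K _ _).trans (forestImage_one φ)
  map_mul' := by
    have : (LinearMap.mul K (HCK K D)).compr₂ (HCK.linearLift K D (forestImage φ)) =
        (LinearMap.mul K (Sh K D)).compl₁₂ (HCK.linearLift K D (forestImage φ))
          (HCK.linearLift K D (forestImage φ)) := by
      refine HCK.hom_ext fun a => HCK.hom_ext fun b => ?_
      simp [HCK.of_mul_of, forestImage_mul]
    exact fun x y => LinearMap.congr_fun₂ this x y

theorem extension_of (c : ForestClass D) : extension φ (HCK.of K c) = forestImage φ c :=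
  HCK.linearLift_of K _ _

theorem treeIncl_single (t : TreeClass D) :
    treeIncl K (Finsupp.single t 1) = HCK.of K t.1 := by
  simp [treeIncl]

theorem extends_extension : Extends φ (extension φ) := by
  intro x
  induction x using Finsupp.induction_linear with
  | zero => simp
  | add x y hx hy => simp only [map_add, hx, hy]
  | single t c =>
    rw [← mul_one c, ← smul_eq_mul, ← Finsupp.smul_single, map_smul, map_smul, map_smul, map_smul,
      treeIncl_single, extension_of, proj_forestImage_of_isTree φ t.2, treeValue_val]

variable {φ} {Φ : HCK K D →ₐc[K] Sh K D}

theorem Extends.counit (Φ : HCK K D →ₐc[K] Sh K D) {c : ForestClass D} (hc : c ≠ 1) :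
    Coalgebra.counit (R := K) (Φ (HCK.of K c)) = 0 := by
  rw [CoalgHomClass.counit_comp_apply, HCK.counit_of, if_neg hc]

/-- The hypothesis fixes π ∘ Φ on trees only. Any other nonempty forest is a product of two nonempty
ones, whose images have counit zero, and π kills such products by `Sh.proj_mul`. -/
theorem Extends.proj_of (h : Extends φ Φ) (c : ForestClass D) :
    Sh.proj K D (Φ (HCK.of K c)) = treeValue φ c := by
  by_cases hc : c.IsTree
  · rw [← treeIncl_single (⟨c, hc⟩ : TreeClass D), h]
    exact (treeValue_val φ ⟨c, hc⟩).symm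
  rw [treeValue, dif_neg hc]
  rcases c.eq_one_or_isTree_or_mul with rfl | hc' | ⟨a, b, ha, hb, rfl⟩
  · rw [← HCK.one_def, map_one, Sh.proj_one]
  · exact absurd hc' hc
  · rw [← HCK.of_mul_of, map_mul, Sh.proj_mul, Extends.counit Φ ha, Extends.counit Φ hb]
    simp

/-- Reconstructing Φ(F) from its counit and coproduct, and moving the coproduct to the forest side,
shows that Φ obeys the recursion of `forestImage_mk`; induction on the number of vertices concludes.
-/
theorem Extends.map_of_mk [Finite V] (h : Extends φ Φ) (F : DecForest V D) :
    Φ (HCK.of K (.mk F)) = forestImage φ (.mk F) := by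
  classical
  have := Fintype.ofFinite V
  induction hn : Nat.card V using Nat.strong_induction_on generalizing V with
  | h n ih =>
    rw [Sh.eq_counit_add_lcons_proj (Φ _), ← CoalgHomClass.map_comp_comul_apply,
      CoalgHomClass.counit_comp_apply, HCK.counit_of, HCK.comul_of_mk, map_sum, map_sum,
      forestImage_mk]
    congr 1
    · simp only [ForestClass.mk_eq_one_iff]
      split_ifs <;> simp
    -- The sum over vertices becomes a sum over the sets `F.up v`. Among the up-closed sets these
    -- are the only trees, so the other terms of the coproduct contribute zero.
    · rw [← Finset.sum_image (s := Finset.univ) (g := F.up) (f := fun U =>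
        Sh.lcons (treeValue φ (.mk (F.induce U))) (forestImage φ (.mk (F.induce Uᶜ))))
        (fun v _ w _ h => F.up_injective h)]
      refine (Finset.sum_subset ?_ ?_).symm.trans (Finset.sum_congr rfl ?_)
      · intro U hU
        obtain ⟨v, -, rfl⟩ := Finset.mem_image.1 hU
        exact F.mem_upSets.2 (F.isUp_up v)
      · intro U hU hU'
        have : ¬ (F.induce U).IsTree := fun hT => hU' <| by
          obtain ⟨v, rfl⟩ := (F.mem_upSets.1 hU).exists_eq_up_of_isTree hT
          exact Finset.mem_image_of_mem _ (Finset.mem_univ v)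
        rw [← ForestClass.isTree_mk_iff] at this
        simp [h.proj_of, treeValue, this]
      · intro U hU
        obtain ⟨v, -, rfl⟩ := Finset.mem_image.1 hU
        simp [h.proj_of,
          ih _ (hn ▸ card_compl_up_lt F.toRootedForest v) _ (Fintype.ofFinite _) rfl]

theorem Extends.eq_extension (h : Extends φ Φ) : Φ = extension φ := by
  refine DFunLike.ext _ _ fun x => ?_
  have : (Φ : HCK K D →ₗ[K] Sh K D) = (extension φ : HCK K D →ₗ[K] Sh K D) :=
    HCK.hom_ext fun c => by
      obtain ⟨n, F, rfl⟩ := c.exists_rep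
      exact (h.map_of_mk F).trans (extension_of φ _).symm
  exact LinearMap.congr_fun this x

end

/-! ### Contractions with a linear order as layerings -/

section

variable {K D : Type*} [Field K] {V W : Type*}

namespace RootedForest

theorem blockMk_eq_of_mem (F : RootedForest V) {e : Set (V × V)} {u w : V} (h : F.edge u w)
    (he : (u, w) ∈ e) : F.blockMk e u = F.blockMk e w := by
  refine SimpleGraph.ConnectedComponent.sound (SimpleGraph.Adj.reachable ⟨fun k => ?_, ?_⟩)
  · exact F.acyclic u (.single (by rwa [← k] at h))
  · exact .inl ⟨h, he⟩

/-- An edge outside `e` with both ends in one block would give a loop in the acyclic `F.cont e`.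
Hence the blocks determine `e`. -/
theorem blockMk_eq_iff_mem (F : RootedForest V) {e : Set (V × V)} {u w : V} (h : F.edge u w) :
    F.blockMk e u = F.blockMk e w ↔ (u, w) ∈ e := by
  refine ⟨fun k => ?_, F.blockMk_eq_of_mem h⟩
  by_contra he
  exact (F.cont e).acyclic (F.blockMk e u) (.single ⟨u, w, rfl, k.symm, h, he⟩)

/-- Edges of `F.part e` never leave a block, so a vertex of the block whose outgoing edge would have
to leave it has none. Every other vertex of the block then has a path down to it. -/
theorem isRooted_supp [Finite V] (F : RootedForest V) (e : Set (V × V)) (C : F.Block e) :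
    F.IsRooted C.supp := by
  obtain ⟨r, hr, h⟩ := (F.part e).exists_exit C.nonempty_supp
  refine ⟨r, hr, fun x hx hxr => ?_⟩
  have hexit : ∀ b, ¬ (F.part e).edge r b := fun b hb =>
    h b hb ((F.blockMk_eq_of_mem hb.1 hb.2).symm.trans hr)
  obtain ⟨y, hxy, hry⟩ := (F.part e).exists_above_above_of_reachable
    (SimpleGraph.ConnectedComponent.exact (hx.trans hr.symm))
  obtain rfl : r = y := by
    rcases Relation.ReflTransGen.cases_head hry with h | ⟨z, hz, _⟩
    · exact h
    · exact absurd hz (hexit z)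
  rcases Relation.ReflTransGen.cases_head hxy with rfl | ⟨z, hz, _⟩
  · exact absurd rfl hxr
  · exact ⟨z, (F.blockMk_eq_of_mem hz.1 hz.2).symm.trans hx, hz.1⟩

/-- The layering given by a contraction and a linear order on its blocks. -/
def LinOrder.layering [Finite V] {F : RootedForest V} {e : Set (V × V)}
    (σ : (F.cont e).LinOrder) : F.Layering (Nat.card (F.Block e)) where
  val v := σ.1 (F.blockMk e v)
  property := by
    refine ⟨fun a b h => ?_, fun i => ?_⟩
    · change σ.1 (F.blockMk e b) ≤ σ.1 (F.blockMk e a)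
      by_cases he : (a, b) ∈ e
      · rw [F.blockMk_eq_of_mem h he]
      · exact σ.2 _ _ (.single ⟨a, b, rfl, rfl, h, he⟩)
    · convert F.isRooted_supp e (σ.1.symm i)
      ext v
      simp [Equiv.eq_symm_apply]

theorem LinOrder.layering_preimage [Finite V] {F : RootedForest V} {e : Set (V × V)}
    (σ : (F.cont e).LinOrder) (i : Fin (Nat.card (F.Block e))) :
    σ.layering.1 ⁻¹' {i} = (σ.1.symm i).supp := by
  ext v
  simp [layering, Equiv.eq_symm_apply]

/-- The number of blocks of a contraction equals `k` only propositionally; comparing the values as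
natural numbers avoids transporting layerings. -/
theorem Layering.sigma_ext {F : RootedForest V} {k l : ℕ} (hkl : k = l) {p : F.Layering k}
    {q : F.Layering l} (h : ∀ v, (p.1 v : ℕ) = q.1 v) :
    (⟨k, p⟩ : Σ k, F.Layering k) = ⟨l, q⟩ := by
  subst hkl
  congr 1
  exact Subtype.ext (funext fun v => Fin.ext (h v))

/-- The contraction of the edges inside the parts of a layering. -/
def Layering.contraction {F : RootedForest V} {k : ℕ} (p : F.Layering k) : F.Contraction :=
  ⟨{x | F.edge x.1 x.2 ∧ p.1 x.1 = p.1 x.2}, fun _ h => h.1⟩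

/-- The contracted edges preserve the numbering. Conversely, each vertex of a part descends to the
root of the part along edges inside it, all of which are contracted. -/
theorem Layering.blockMk_eq_iff [Finite V] {F : RootedForest V} {k : ℕ} (p : F.Layering k)
    (u w : V) :
    F.blockMk p.contraction.1 u = F.blockMk p.contraction.1 w ↔ p.1 u = p.1 w := by
  constructor
  · intro h
    have hr := SimpleGraph.ConnectedComponent.exact h
    rw [SimpleGraph.reachable_iff_reflTransGen] at hr
    clear h
    induction hr with
    | refl => rfl
    | tail _ h ih =>
      rcases h.2 with h | h
      · exact ih.trans h.2.2
      · exact ih.trans h.2.2.symm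
  · intro h
    obtain ⟨r, -, hr⟩ := p.2.2 (p.1 u)
    have key : ∀ x, p.1 x = p.1 u →
        F.blockMk p.contraction.1 x = F.blockMk p.contraction.1 r := by
      intro x hx
      induction x using F.wellFounded_edge.induction with
      | h x ih =>
        by_cases e : x = r
        · rw [e]
        · obtain ⟨y, hy, hxy⟩ := hr x hx e
          have hm : (x, y) ∈ p.contraction.1 := ⟨hxy, hx.trans (Eq.symm hy)⟩
          exact (F.blockMk_eq_of_mem hxy hm).trans (ih y hxy hy)
    rw [key u rfl, key w h.symm]

/-- The numbering of the blocks of the contraction of a layering. -/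
noncomputable def Layering.blockEquiv [Finite V] {F : RootedForest V} {k : ℕ}
    (p : F.Layering k) : F.Block p.contraction.1 ≃ Fin k :=
  Equiv.ofBijective
    (Quot.lift p.1 fun u w h => (p.blockMk_eq_iff u w).1 (SimpleGraph.ConnectedComponent.sound h))
    ⟨by
      intro C C'
      induction C using SimpleGraph.ConnectedComponent.ind
      induction C' using SimpleGraph.ConnectedComponent.ind
      exact (p.blockMk_eq_iff _ _).2, fun i => by
      obtain ⟨v, hv⟩ := p.surjective i
      exact ⟨F.blockMk _ v, hv⟩⟩

theorem Layering.card_block [Finite V] {F : RootedForest V} {k : ℕ} (p : F.Layering k) :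
    Nat.card (F.Block p.contraction.1) = k := by
  simpa using Nat.card_congr p.blockEquiv

/-- The linear order on the blocks of the contraction of a layering. -/
noncomputable def Layering.linOrder [Finite V] {F : RootedForest V} {k : ℕ} (p : F.Layering k) :
    (F.cont p.contraction.1).LinOrder where
  val := p.blockEquiv.trans (finCongr p.card_block.symm)
  property := by
    intro C C' h
    induction h with
    | refl => exact le_rfl
    | tail _ h ih =>
      obtain ⟨u, w, rfl, rfl, huw, -⟩ := h
      exact le_trans (p.2.1 u w huw) ih

/-- The contractions with a linear order correspond to the layerings. -/
theorem LinOrder.layering_bijective [Finite V] (F : RootedForest V) : Function.Bijective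
    fun x : (Σ e : F.Contraction, (F.cont e.1).LinOrder) =>
      (⟨_, x.2.layering⟩ : Σ k, F.Layering k) := by
  constructor
  · rintro ⟨⟨e, he⟩, σ⟩ ⟨⟨e', he'⟩, σ'⟩ h
    have hv : ∀ v, (σ.1 (F.blockMk e v) : ℕ) = σ'.1 (F.blockMk e' v) := fun v =>
      congrArg (fun x : Σ k, F.Layering k => (x.2.1 v : ℕ)) h
    -- An edge belongs to the contraction exactly when its two ends carry the same number.
    obtain rfl : e = e' := by
      have key : ∀ u w, F.edge u w → ((u, w) ∈ e ↔ (u, w) ∈ e') := fun u w h => by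
        rw [← F.blockMk_eq_iff_mem h, ← F.blockMk_eq_iff_mem h, ← σ.1.injective.eq_iff,
          ← σ'.1.injective.eq_iff, Fin.ext_iff, Fin.ext_iff, hv, hv]
      ext ⟨u, w⟩
      exact ⟨fun h => (key u w (he h)).1 h, fun h => (key u w (he' h)).2 h⟩
    congr 1
    refine Subtype.ext (Equiv.ext fun C => ?_)
    induction C using SimpleGraph.ConnectedComponent.ind with
    | h v => exact Fin.ext (hv v)
  · rintro ⟨k, p⟩
    exact ⟨⟨p.contraction, p.linOrder⟩, Layering.sigma_ext p.card_block fun v => rfl⟩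

end RootedForest

variable (φ : (TreeClass D →₀ K) →ₗ[K] (D →₀ K))

/-- Every edge of `F` within one block already lies in `e`, so the component of `F.part e` and the
subforest of `F` on the same vertices are the same tree. -/
theorem orderWord_eq_layerWord [Finite V] (F : DecForest V D) (e : Set (V × V))
    (σ : (F.cont e).LinOrder) : orderWord φ F e σ = layerWord φ F σ.layering := by
  refine congrArg Sh.tensorWord (congrArg List.ofFn (funext fun i => ?_))
  have h : (F.blockTree e (σ.1.symm i.rev)).1 = .mk (F.induce (σ.layering.1 ⁻¹' {i.rev})) := by
    rw [ForestClass.mk_induce_congr F (σ.layering_preimage i.rev)]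
    refine ForestClass.mk_eq_mk.2 ⟨Equiv.refl _, fun u w => ?_, fun _ => rfl⟩
    refine ⟨fun k => ⟨k, ?_⟩, fun k => k.1⟩
    exact (F.blockMk_eq_iff_mem k).1 (u.2.trans w.2.symm)
  rw [← h]
  exact (treeValue_val φ _).symm

theorem sum_orderWord [Finite V] (F : DecForest V D) :
    ∑ e : F.Contraction, ∑ σ : (F.cont e.1).LinOrder, orderWord φ F e.1 σ =
      forestImage φ (.mk F) := by
  rw [forestImage_mk_of_lt φ F (Nat.lt_succ_self _), Finset.sum_sigma']
  · simp only [layerSum]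
    rw [Finset.sum_sigma']
    refine Finset.sum_bij (fun x _ => ⟨_, x.2.layering⟩) (fun x _ => ?_)
      (fun x _ y _ h => (RootedForest.LinOrder.layering_bijective F.toRootedForest).1 h)
      (fun y _ => ?_) fun x _ => orderWord_eq_layerWord φ F x.1.1 x.2
    · simpa [Nat.lt_succ_iff] using x.2.layering.le_card
    · obtain ⟨x, hx⟩ := (RootedForest.LinOrder.layering_bijective F.toRootedForest).2 y
      exact ⟨x, by simp, hx⟩

end

end CKShuffle

theorem mainTheorem9 {K D : Type*} [Field K] [CharZero K] [Nonempty D]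
    (φ : (CKShuffle.TreeClass D →₀ K) →ₗ[K] (D →₀ K)) :
    (∃! Φ : CKShuffle.HCK K D →ₐc[K] CKShuffle.Sh K D, CKShuffle.Extends φ Φ) ∧
    ∀ Φ : CKShuffle.HCK K D →ₐc[K] CKShuffle.Sh K D, CKShuffle.Extends φ Φ →
      ∀ (V : Type*) [Finite V] (T : CKShuffle.DecForest V D), T.IsTree →
        Φ (CKShuffle.HCK.of K (CKShuffle.ForestClass.mk T)) =
          ∑ e : T.Contraction, ∑ σ : (T.cont e.1).LinOrder, CKShuffle.orderWord φ T e.1 σ := by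
  refine ⟨⟨CKShuffle.extension φ, CKShuffle.extends_extension φ, fun Φ h => h.eq_extension⟩, ?_⟩
  intro Φ h V _ T _
  rw [h.map_of_mk, CKShuffle.sum_orderWord]
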